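/- Let $\mathbb D$ and $\mathbb T$ be the open unit disc and the unit circle in $\mathbb C$. Let $H^2(\mathbb D^2)$ be the Hilbert space of holomorphic functions $f$ on $\mathbb D^2$ with $\sup_{0\le t<1}\int_{\mathbb T^2}|f(t\zeta)|^2\,dm(\zeta)<\infty$, where $m$ is normalized Lebesgue measure on $\mathbb T^2$, with inner product $\langle f,g\rangle=\lim_{t\to1^-}\int_{\mathbb T^2}f(t\zeta)\overline{g(t\zeta)}\,dm(\zeta)$. Let $M_1,M_2$ be the operators of multiplication by the coordinates $z,w$ on $H^2(\mathbb D^2)$. A quotient module is a closed subspace $\mathfrak Q\subseteq H^2(\mathbb D^2)$ with $M_i^*\mathfrak Q\subseteq\mathfrak Q$ for $i=1,2$. With $P_{\mathfrak Q}$ the orthogonal projection onto $\mathfrak Q$ and $Q_i=P_{\mathfrak Q}M_i|_{\mathfrak Q}$, it is called $\varphi$-doubly commuting if $Q_1Q_2Q_2^*=Q_2^*Q_1Q_2$ on $\mathfrak Q$. An inner function on $\mathbb D$ is a bounded holomorphic function on $\mathbb D$ whose radial limits exist and have modulus one at almost every point of $\mathbb T$. **Theorem.** Let $\theta_1$ and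 $\theta_2$ be inner functions on $\mathbb D$ such that $\theta_1(a)=\theta_2(b)=0$ for some $a,b\in\mathbb D$. Then the quotient module $$\mathfrak Q=H^2(\mathbb D^2)\ominus\theta_1(z)\theta_2(w)H^2(\mathbb D^2)$$ is $\varphi$-doubly commuting if and only if there are $c_1,c_2\in\mathbb T$ such that $\theta_1(z)=c_1z$ and $\theta_2(w)=c_2w$ for all $z,w\in\mathbb D$. -/

import Mathlib

noncomputable section

namespace BidiscHardy

open Set Filter Topology MeasureTheory
open scoped ComplexConjugate ENNReal

/-- The open unit bidisc. -/
def bidisc : Set (ℂ × ℂ) := Metric.ball 0 1 ×ˢ Metric.ball 0 1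

/-- The normalized Lebesgue (Haar) measure on the torus, which is parametrized by `(ℝ / ℤ)²`. -/
def torusMeasure : Measure (UnitAddTorus (Fin 2)) :=
  Measure.pi fun _ => AddCircle.haarAddCircle

/-- The point `(s e^{2π i x₀}, t e^{2π i x₁})` of the torus of radii `s, t`. -/
def torusPoint (s t : ℝ) (x : UnitAddTorus (Fin 2)) : ℂ × ℂ :=
  ((s : ℂ) * (AddCircle.toCircle (x 0) : ℂ), (t : ℂ) * (AddCircle.toCircle (x 1) : ℂ))

instance : IsProbabilityMeasure torusMeasure := by unfold torusMeasure; infer_instance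

lemma continuous_torusPoint (s t : ℝ) : Continuous (torusPoint s t) := by
  unfold torusPoint
  have h : Continuous (fun x : UnitAddCircle => (AddCircle.toCircle x : ℂ)) :=
    continuous_induced_dom.comp AddCircle.continuous_toCircle
  exact (continuous_const.mul (h.comp (continuous_apply 0))).prodMk
    (continuous_const.mul (h.comp (continuous_apply 1)))

lemma norm_mul_toCircle_lt {s : ℝ} (hs : s ∈ Ico (0 : ℝ) 1) (x : UnitAddCircle) :
    (s : ℂ) * (AddCircle.toCircle x : ℂ) ∈ Metric.ball (0 : ℂ) 1 := by
  simp [abs_of_nonneg hs.1, hs.2, Circle.norm_coe]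

lemma torusPoint_mem {s t : ℝ} (hs : s ∈ Ico (0 : ℝ) 1) (ht : t ∈ Ico (0 : ℝ) 1)
    (x : UnitAddTorus (Fin 2)) : torusPoint s t x ∈ bidisc :=
  ⟨norm_mul_toCircle_lt hs _, norm_mul_toCircle_lt ht _⟩

lemma continuous_slice {f : ℂ × ℂ → ℂ} (hf : DifferentiableOn ℂ f bidisc) {s t : ℝ}
    (hs : s ∈ Ico (0 : ℝ) 1) (ht : t ∈ Ico (0 : ℝ) 1) :
    Continuous fun x => f (torusPoint s t x) :=
  hf.continuousOn.comp_continuous (continuous_torusPoint s t) (torusPoint_mem hs ht)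

/-- Fourier coefficients of the restriction of `f` to the torus of radii `s, t`. -/
def torusCoeff (f : ℂ × ℂ → ℂ) (s t : ℝ) (k : Fin 2 → ℤ) : ℂ :=
  ∫ x, UnitAddTorus.mFourier (-k) x * f (torusPoint s t x) ∂torusMeasure

lemma integral_conj_mul_hasSum {F G : UnitAddTorus (Fin 2) → ℂ} (hF : Continuous F)
    (hG : Continuous G) :
    HasSum (fun k : Fin 2 → ℤ =>
      conj (∫ x, UnitAddTorus.mFourier (-k) x * F x ∂torusMeasure) *
        ∫ x, UnitAddTorus.mFourier (-k) x * G x ∂torusMeasure)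
      (∫ x, conj (F x) * G x ∂torusMeasure) := by
  have h := UnitAddTorus.hasSum_prod_mFourierCoeff
    (ContinuousMap.toLp (E := ℂ) 2 torusMeasure ℂ ⟨F, hF⟩)
    (ContinuousMap.toLp (E := ℂ) 2 torusMeasure ℂ ⟨G, hG⟩)
  have e : ∀ (H : C(UnitAddTorus (Fin 2), ℂ)) (k : Fin 2 → ℤ),
      UnitAddTorus.mFourierCoeff (ContinuousMap.toLp (E := ℂ) 2 torusMeasure ℂ H) k
        = ∫ x, UnitAddTorus.mFourier (-k) x * H x ∂torusMeasure := fun H k =>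
    UnitAddTorus.mFourierCoeff_toLp H k
  convert h using 1
  · ext k
    exact congrArg₂ (fun u v : ℂ => conj u * v) (e ⟨F, hF⟩ k).symm (e ⟨G, hG⟩ k).symm
  apply integral_congr_ae
  filter_upwards [ContinuousMap.coeFn_toLp (E := ℂ) (p := 2) (𝕜 := ℂ) torusMeasure ⟨F, hF⟩,
    ContinuousMap.coeFn_toLp (E := ℂ) (p := 2) (𝕜 := ℂ) torusMeasure ⟨G, hG⟩] with x h1 h2
  erw [h1, h2]
  rfl

lemma integral_mFourier (k j : Fin 2 → ℤ) :
    ∫ x, UnitAddTorus.mFourier (-k) x * UnitAddTorus.mFourier j x ∂torusMeasure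
      = if k = j then 1 else 0 := by
  have h := orthonormal_iff_ite.mp (UnitAddTorus.orthonormal_mFourier (d := Fin 2)) k j
  rw [← h, ContinuousMap.inner_toLp]
  refine integral_congr_ae (ae_of_all _ fun x => ?_)
  simp only [UnitAddTorus.mFourier_neg]
  exact mul_comm _ _

lemma integral_fourier (k j : ℤ) :
    ∫ x : UnitAddCircle, fourier (-k) x * fourier j x ∂AddCircle.haarAddCircle
      = if k = j then 1 else 0 := by
  have h := orthonormal_iff_ite.mp (orthonormal_fourier (T := (1 : ℝ))) k j
  rw [← h, ContinuousMap.inner_toLp]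
  refine integral_congr_ae (ae_of_all _ fun x => ?_)
  simp only [fourier_neg]
  exact mul_comm _ _

/-- Fourier coefficients of a holomorphic function of one variable on circles. -/
lemma exists_disc_coeff {g : ℂ → ℂ} (hg : DifferentiableOn ℂ g (Metric.ball 0 1)) (k : ℤ) :
    ∃ b : ℂ, (k < 0 → b = 0) ∧ ∀ s ∈ Ico (0 : ℝ) 1,
      ∫ x : UnitAddCircle, fourier (-k) x * g ((s : ℂ) * (AddCircle.toCircle x : ℂ))
        ∂AddCircle.haarAddCircle = b * (s : ℂ) ^ k.toNat := by
  classical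
  refine ⟨if k < 0 then 0 else (k.toNat.factorial : ℂ)⁻¹ * iteratedDeriv k.toNat g 0,
    fun h => if_pos h, fun s hs => ?_⟩
  set b : ℕ → ℂ := fun n => (n.factorial : ℂ)⁻¹ * iteratedDeriv n g 0 with hb
  have hT : ∀ z ∈ Metric.ball (0 : ℂ) 1, HasSum (fun n => b n * z ^ n) (g z) := by
    intro z hz
    have := Complex.hasSum_taylorSeries_on_ball (c := 0) (r := 1) (f := g) (by simpa using hg)
      (z := z) (by simpa using hz)
    have e : (fun n => b n * z ^ n) =
        fun n : ℕ => (n.factorial : ℂ)⁻¹ • (z - 0) ^ n • iteratedDeriv n g 0 := by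
      ext n
      simp only [hb, sub_zero, smul_eq_mul]
      ring
    rwa [e]
  have hsum : Summable fun n => ‖b n‖ * s ^ n := by
    have := (hT s (by simp [abs_of_nonneg hs.1, hs.2])).summable.norm
    simpa [abs_of_nonneg hs.1] using this
  have e : ∀ x : UnitAddCircle, fourier (-k) x * g ((s : ℂ) * (AddCircle.toCircle x : ℂ))
      = ∑' n : ℕ, (b n * (s : ℂ) ^ n) * (fourier (-k) x * fourier (n : ℤ) x) := by
    intro x
    rw [← (hT _ (norm_mul_toCircle_lt hs x)).tsum_eq, ← tsum_mul_left]
    congr 1; ext n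
    have : fourier (n : ℤ) x = (AddCircle.toCircle x : ℂ) ^ n := by
      simp [fourier_apply, AddCircle.toCircle_nsmul]
    rw [this]; ring
  simp_rw [e]
  have hc : ∀ n : ℕ, Continuous fun x : UnitAddCircle =>
      (b n * (s : ℂ) ^ n) * (fourier (-k) x * fourier (n : ℤ) x) := fun n => by fun_prop
  rw [← integral_tsum_of_summable_integral_norm
    (fun n => (hc n).integrable_of_hasCompactSupport (HasCompactSupport.of_compactSpace _))]
  · simp_rw [integral_const_mul, integral_fourier]
    split_ifs with hk
    · rw [zero_mul]
      convert tsum_zero with n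
      rw [if_neg (by omega), mul_zero]
    · rw [tsum_eq_single k.toNat]
      · rw [if_pos (by omega), mul_one]
      · intro n hn
        rw [if_neg (by omega), mul_zero]
  · convert hsum using 2 with n
    simp [abs_of_nonneg hs.1, fourier_apply, Circle.norm_coe]


lemma torusCoeff_iterated (f : ℂ × ℂ → ℂ) (s t : ℝ) (k : Fin 2 → ℤ) :
    torusCoeff f s t k = ∫ x : UnitAddCircle × UnitAddCircle,
      fourier (-k 0) x.1 * (fourier (-k 1) x.2 *
      f ((s : ℂ) * (AddCircle.toCircle x.1 : ℂ), (t : ℂ) * (AddCircle.toCircle x.2 : ℂ)))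
       ∂(AddCircle.haarAddCircle.prod AddCircle.haarAddCircle) := by
  have h := measurePreserving_finTwoArrow (AddCircle.haarAddCircle (T := (1 : ℝ)))
  rw [← h.integral_comp (MeasurableEquiv.measurableEmbedding _)]
  unfold torusCoeff torusMeasure
  refine integral_congr_ae (ae_of_all _ fun x => ?_)
  simp [UnitAddTorus.mFourier, torusPoint, mul_assoc]

lemma continuous_toCircle_coe : Continuous (fun x : UnitAddCircle => (AddCircle.toCircle x : ℂ)) :=
  continuous_induced_dom.comp AddCircle.continuous_toCircle

lemma integrable_iterated {f : ℂ × ℂ → ℂ} (hf : DifferentiableOn ℂ f bidisc) {s t : ℝ}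
    (hs : s ∈ Ico (0 : ℝ) 1) (ht : t ∈ Ico (0 : ℝ) 1) (k : Fin 2 → ℤ) :
    Integrable (fun x : UnitAddCircle × UnitAddCircle =>
      fourier (-k 0) x.1 * (fourier (-k 1) x.2 *
      f ((s : ℂ) * (AddCircle.toCircle x.1 : ℂ), (t : ℂ) * (AddCircle.toCircle x.2 : ℂ))))
       (AddCircle.haarAddCircle.prod AddCircle.haarAddCircle) := by
  refine Continuous.integrable_of_hasCompactSupport ?_ (HasCompactSupport.of_compactSpace _)
  have h1 : Continuous fun x : UnitAddCircle × UnitAddCircle =>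
      f ((s : ℂ) * (AddCircle.toCircle x.1 : ℂ), (t : ℂ) * (AddCircle.toCircle x.2 : ℂ)) := by
    refine hf.continuousOn.comp_continuous ?_ fun x =>
      ⟨norm_mul_toCircle_lt hs _, norm_mul_toCircle_lt ht _⟩
    exact (continuous_const.mul (continuous_toCircle_coe.comp continuous_fst)).prodMk
      (continuous_const.mul (continuous_toCircle_coe.comp continuous_snd))
  exact ((fourier (-k 0)).continuous.comp continuous_fst).mul
    (((fourier (-k 1)).continuous.comp continuous_snd).mul h1)

lemma torusCoeff_fst {f : ℂ × ℂ → ℂ} (hf : DifferentiableOn ℂ f bidisc) {t : ℝ}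
    (ht : t ∈ Ico (0 : ℝ) 1) (k : Fin 2 → ℤ) :
    ∃ b : ℂ, (k 0 < 0 → b = 0) ∧ ∀ s ∈ Ico (0 : ℝ) 1,
      torusCoeff f s t k = b * (s : ℂ) ^ (k 0).toNat := by
  have hd : ∀ y : UnitAddCircle, DifferentiableOn ℂ
      (fun z => f (z, (t : ℂ) * (AddCircle.toCircle y : ℂ))) (Metric.ball 0 1) := fun y =>
    hf.comp (by fun_prop) fun z hz => ⟨hz, norm_mul_toCircle_lt ht y⟩
  choose B hB0 hB using fun y => exists_disc_coeff (hd y) (k 0)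
  refine ⟨∫ y, fourier (-k 1) y * B y ∂AddCircle.haarAddCircle, fun h => ?_, fun s hs => ?_⟩
  · simp [hB0 _ h]
  · rw [torusCoeff_iterated, integral_prod_symm _ (integrable_iterated hf hs ht k),
      ← integral_mul_const]
    refine integral_congr_ae (ae_of_all _ fun y => ?_)
    simp only
    rw [mul_assoc, ← hB y s hs, ← integral_const_mul]
    refine integral_congr_ae (ae_of_all _ fun x => ?_)
    simp only
    ring

lemma torusCoeff_snd {f : ℂ × ℂ → ℂ} (hf : DifferentiableOn ℂ f bidisc) {s : ℝ}
    (hs : s ∈ Ico (0 : ℝ) 1) (k : Fin 2 → ℤ) :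
    ∃ b : ℂ, (k 1 < 0 → b = 0) ∧ ∀ t ∈ Ico (0 : ℝ) 1,
      torusCoeff f s t k = b * (t : ℂ) ^ (k 1).toNat := by
  have hd : ∀ y : UnitAddCircle, DifferentiableOn ℂ
      (fun z => f ((s : ℂ) * (AddCircle.toCircle y : ℂ), z)) (Metric.ball 0 1) := fun y =>
    hf.comp (by fun_prop) fun z hz => ⟨norm_mul_toCircle_lt hs y, hz⟩
  choose B hB0 hB using fun y => exists_disc_coeff (hd y) (k 1)
  refine ⟨∫ y, fourier (-k 0) y * B y ∂AddCircle.haarAddCircle, fun h => ?_, fun t ht => ?_⟩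
  · simp [hB0 _ h]
  · rw [torusCoeff_iterated, integral_prod _ (integrable_iterated hf hs ht k),
      ← integral_mul_const]
    refine integral_congr_ae (ae_of_all _ fun y => ?_)
    simp only
    rw [mul_assoc, ← hB y t ht, ← integral_const_mul]

/-- A pair of natural numbers as a multi-index of Fourier coefficients. -/
def index (p : ℕ × ℕ) : Fin 2 → ℤ := ![(p.1 : ℤ), (p.2 : ℤ)]

lemma index_injective : Function.Injective index := fun p q h => by
  have h0 := congrFun h 0
  have h1 := congrFun h 1
  simp [index] at h0 h1
  exact Prod.ext h0 h1

/-- The Taylor coefficient of `z ^ p.1 * w ^ p.2` at the origin. -/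
def taylorCoeff (f : ℂ × ℂ → ℂ) (p : ℕ × ℕ) : ℂ :=
  2 ^ (p.1 + p.2) * torusCoeff f 2⁻¹ 2⁻¹ (index p)

lemma half_mem : (2⁻¹ : ℝ) ∈ Ico (0 : ℝ) 1 := by norm_num

lemma torusCoeff_index {f : ℂ × ℂ → ℂ} (hf : DifferentiableOn ℂ f bidisc) {s t : ℝ}
    (hs : s ∈ Ico (0 : ℝ) 1) (ht : t ∈ Ico (0 : ℝ) 1) (p : ℕ × ℕ) :
    torusCoeff f s t (index p) = taylorCoeff f p * ((s : ℂ) ^ p.1 * (t : ℂ) ^ p.2) := by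
  obtain ⟨b, -, hb⟩ := torusCoeff_fst hf ht (index p)
  obtain ⟨c, -, hc⟩ := torusCoeff_snd hf half_mem (index p)
  have h1 := hb s hs
  have h2 := hb _ half_mem
  have h3 := hc t ht
  have h4 := hc _ half_mem
  simp only [index, Matrix.cons_val_zero, Matrix.cons_val_one, Int.toNat_natCast] at h1 h2 h3 h4
  rw [h3] at h2
  simp only [taylorCoeff, index]
  rw [h1, h4]
  push_cast at h2 ⊢
  have e1 : (2 : ℂ) ^ p.1 * 2⁻¹ ^ p.1 = 1 := by rw [← mul_pow]; norm_num
  have e2 : (2 : ℂ) ^ p.2 * 2⁻¹ ^ p.2 = 1 := by rw [← mul_pow]; norm_num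
  have hb' : b = 2 ^ p.1 * (c * (t : ℂ) ^ p.2) := by
    rw [h2]; linear_combination (-b) * e1
  rw [hb', pow_add]
  linear_combination (-(2 : ℂ) ^ p.1 * c * s ^ p.1 * t ^ p.2) * e2

lemma torusCoeff_eq_zero {f : ℂ × ℂ → ℂ} (hf : DifferentiableOn ℂ f bidisc) {s t : ℝ}
    (hs : s ∈ Ico (0 : ℝ) 1) (ht : t ∈ Ico (0 : ℝ) 1) {k : Fin 2 → ℤ} (hk : k ∉ range index) :
    torusCoeff f s t k = 0 := by
  obtain ⟨b, hb0, hb⟩ := torusCoeff_fst hf ht k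
  obtain ⟨c, hc0, hc⟩ := torusCoeff_snd hf hs k
  by_cases h0 : k 0 < 0
  · rw [hb s hs, hb0 h0, zero_mul]
  by_cases h1 : k 1 < 0
  · rw [hc t ht, hc0 h1, zero_mul]
  refine absurd ⟨((k 0).toNat, (k 1).toNat), ?_⟩ hk
  ext i
  fin_cases i <;> simp [index] <;> omega

/-- Orthogonality of monomials on the torus of radius `t`. -/
lemma hasSum_integral {f g : ℂ × ℂ → ℂ} (hf : DifferentiableOn ℂ f bidisc)
    (hg : DifferentiableOn ℂ g bidisc) {t : ℝ} (ht : t ∈ Ico (0 : ℝ) 1) :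
    HasSum (fun p : ℕ × ℕ => (conj (taylorCoeff f p) * taylorCoeff g p) *
      ((t ^ (p.1 + p.2)) ^ 2 : ℝ))
      (∫ x, conj (f (torusPoint t t x)) * g (torusPoint t t x) ∂torusMeasure) := by
  have h := integral_conj_mul_hasSum (continuous_slice hf ht ht) (continuous_slice hg ht ht)
  change HasSum (fun k => conj (torusCoeff f t t k) * torusCoeff g t t k) _ at h
  rw [← index_injective.hasSum_iff] at h
  · convert h using 1
    ext p
    simp only [Function.comp_apply, torusCoeff_index hf ht ht, torusCoeff_index hg ht ht, map_mul,
      map_pow, Complex.conj_ofReal]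
    push_cast
    ring
  · intro k hk
    rw [torusCoeff_eq_zero hg ht ht hk, mul_zero]

lemma exists_torusPoint (z : ℂ × ℂ) : ∃ x, torusPoint ‖z.1‖ ‖z.2‖ x = z := by
  have h : ∀ u : ℂ, ∃ x : UnitAddCircle, (‖u‖ : ℂ) * (AddCircle.toCircle x : ℂ) = u := fun u =>
    ⟨((u.arg / (2 * Real.pi) : ℝ) : UnitAddCircle), by
      rw [AddCircle.toCircle_apply_mk, Circle.coe_exp]
      conv_rhs => rw [← Complex.norm_mul_exp_arg_mul_I u]
      have : (Real.pi : ℂ) ≠ 0 := by exact_mod_cast Real.pi_ne_zero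
      congr 3
      push_cast
      field_simp⟩
  obtain ⟨x, hx⟩ := h z.1
  obtain ⟨y, hy⟩ := h z.2
  exact ⟨![x, y], Prod.ext (by simpa [torusPoint] using hx) (by simpa [torusPoint] using hy)⟩

lemma summable_geom {r s : ℝ} (hr : r ∈ Ico (0 : ℝ) 1) (hs : s ∈ Ico (0 : ℝ) 1) :
    Summable fun p : ℕ × ℕ => r ^ p.1 * s ^ p.2 :=
  (summable_geometric_of_lt_one hr.1 hr.2).mul_of_nonneg (summable_geometric_of_lt_one hs.1 hs.2)
    (fun _ => pow_nonneg hr.1 _) (fun _ => pow_nonneg hs.1 _)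

/-- A holomorphic function with bounded Taylor coefficients is the sum of its Taylor series. -/
lemma hasSum_taylor {f : ℂ × ℂ → ℂ} (hf : DifferentiableOn ℂ f bidisc) {C : ℝ}
    (hC : ∀ p, ‖taylorCoeff f p‖ ≤ C) {z : ℂ × ℂ} (hz : z ∈ bidisc) :
    HasSum (fun p : ℕ × ℕ => taylorCoeff f p * (z.1 ^ p.1 * z.2 ^ p.2)) (f z) := by
  have h1 : ‖z.1‖ ∈ Ico (0 : ℝ) 1 := ⟨norm_nonneg _, by simpa using hz.1⟩
  have h2 : ‖z.2‖ ∈ Ico (0 : ℝ) 1 := ⟨norm_nonneg _, by simpa using hz.2⟩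
  obtain ⟨x, hx⟩ := exists_torusPoint z
  let F : C(UnitAddTorus (Fin 2), ℂ) := ⟨_, continuous_slice hf h1 h2⟩
  have hF : ∀ k, UnitAddTorus.mFourierCoeff F k = torusCoeff f ‖z.1‖ ‖z.2‖ k := fun k => rfl
  have hs : Summable (UnitAddTorus.mFourierCoeff F) := by
    rw [← index_injective.summable_iff]
    · refine Summable.of_norm_bounded ((summable_geom h1 h2).mul_left C) fun p => ?_
      simp only [Function.comp_apply, hF, torusCoeff_index hf h1 h2, norm_mul, norm_pow,
        Complex.norm_real, norm_norm]
      gcongr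
      exact hC p
    · intro k hk
      rw [hF, torusCoeff_eq_zero hf h1 h2 hk]
  have h := UnitAddTorus.hasSum_mFourier_series_apply_of_summable hs x
  rw [← index_injective.hasSum_iff] at h
  · convert h using 1
    · ext p
      simp only [Function.comp_apply, hF, torusCoeff_index hf h1 h2, smul_eq_mul]
      conv_lhs => rw [← hx]
      simp [torusPoint, UnitAddTorus.mFourier, index, AddCircle.toCircle_nsmul, mul_pow]
      ring
    · conv_lhs => rw [← hx]
      rfl
  · intro k hk
    rw [hF, torusCoeff_eq_zero hf h1 h2 hk, zero_smul]

/-- The mean of `|f|^2` over the torus of radius `t`. -/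
def sqMean (f : ℂ × ℂ → ℂ) (t : ℝ) : ℝ := ∫ x, ‖f (torusPoint t t x)‖ ^ 2 ∂torusMeasure

lemma integrable_sq {f : ℂ × ℂ → ℂ} (hf : DifferentiableOn ℂ f bidisc) {t : ℝ}
    (ht : t ∈ Ico (0 : ℝ) 1) :
    Integrable (fun x => ‖f (torusPoint t t x)‖ ^ 2) torusMeasure :=
  ((continuous_slice hf ht ht).norm.pow 2).integrable_of_hasCompactSupport
    (HasCompactSupport.of_compactSpace _)

/-- Membership in the Hardy space of the bidisc: `f` is holomorphic on the bidisc and its square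
means over the tori of radius `t < 1` are bounded. A function on the bidisc is represented by its
extension by zero to `ℂ × ℂ`, so that equality of functions is equality on the bidisc. -/
structure MemHardy (f : ℂ × ℂ → ℂ) : Prop where
  differentiableOn : DifferentiableOn ℂ f bidisc
  eq_zero : ∀ p, p ∉ bidisc → f p = 0
  bddAbove : BddAbove (sqMean f '' Ico (0 : ℝ) 1)

/-- The vector space of functions underlying the Hardy space of the bidisc. -/
def hardySubmodule : Submodule ℂ (ℂ × ℂ → ℂ) where
  carrier := {f | MemHardy f}
  zero_mem' := ⟨differentiableOn_const 0, fun _ _ => rfl, 0, by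
    rintro _ ⟨t, -, rfl⟩; simp [sqMean]⟩
  add_mem' := by
    rintro f g ⟨hf, hf0, C, hC⟩ ⟨hg, hg0, D, hD⟩
    refine ⟨hf.add hg, fun p hp => by simp [hf0 p hp, hg0 p hp], 2 * (C + D), ?_⟩
    rintro _ ⟨t, ht, rfl⟩
    have h : sqMean (f + g) t ≤ 2 * (sqMean f t + sqMean g t) := by
      unfold sqMean
      rw [← integral_add (integrable_sq hf ht) (integrable_sq hg ht), ← integral_const_mul]
      refine integral_mono (integrable_sq (hf.add hg) ht)
        (((integrable_sq hf ht).add (integrable_sq hg ht)).const_mul 2) fun x => ?_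
      simp only [Pi.add_apply]
      nlinarith [norm_add_le (f (torusPoint t t x)) (g (torusPoint t t x)),
        norm_nonneg (f (torusPoint t t x) + g (torusPoint t t x)),
        sq_nonneg (‖f (torusPoint t t x)‖ - ‖g (torusPoint t t x)‖)]
    linarith [hC (mem_image_of_mem _ ht), hD (mem_image_of_mem _ ht)]
  smul_mem' := by
    rintro c f ⟨hf, hf0, C, hC⟩
    refine ⟨hf.const_smul c, fun p hp => by simp [hf0 p hp], ‖c‖ ^ 2 * C, ?_⟩
    rintro _ ⟨t, ht, rfl⟩
    have h : sqMean (c • f) t = ‖c‖ ^ 2 * sqMean f t := by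
      simp [sqMean, mul_pow, integral_const_mul]
    rw [h]
    exact mul_le_mul_of_nonneg_left (hC (mem_image_of_mem _ ht)) (by positivity)

/-- The Hardy space of the bidisc. -/
def Hardy : Type := hardySubmodule

instance : AddCommGroup Hardy := inferInstanceAs (AddCommGroup hardySubmodule)
instance : Module ℂ Hardy := inferInstanceAs (Module ℂ hardySubmodule)

namespace Hardy

/-- The function on the bidisc, extended by zero. -/
def toFun (f : Hardy) : ℂ × ℂ → ℂ := Subtype.val f

/-- The element of the Hardy space given by a function. -/
def mk (f : ℂ × ℂ → ℂ) (hf : MemHardy f) : Hardy := ⟨f, hf⟩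

instance : CoeFun Hardy fun _ => ℂ × ℂ → ℂ := ⟨toFun⟩

/-- The inner product of the Hardy space: the limit of the means of `conj f * g` over the tori of
radius `t` as `t` increases to one. -/
def innerProd (f g : Hardy) : ℂ :=
  limUnder (𝓝[<] (1 : ℝ)) fun t =>
    ∫ x, conj (f (torusPoint t t x)) * g (torusPoint t t x) ∂torusMeasure

lemma memHardy (f : Hardy) : MemHardy f := f.2

@[simp] lemma mk_apply (f : ℂ × ℂ → ℂ) (hf : MemHardy f) (p : ℂ × ℂ) : mk f hf p = f p := rfl

@[ext] lemma ext {f g : Hardy} (h : ∀ p ∈ bidisc, f p = g p) : f = g := by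
  refine Subtype.ext (funext fun p => ?_)
  by_cases hp : p ∈ bidisc
  · exact h p hp
  · exact (f.memHardy.eq_zero p hp).trans (g.memHardy.eq_zero p hp).symm

@[simp] lemma add_apply (f g : Hardy) (p : ℂ × ℂ) : (f + g) p = f p + g p := rfl
@[simp] lemma smul_apply (c : ℂ) (f : Hardy) (p : ℂ × ℂ) : (c • f) p = c * f p := rfl

lemma differentiableOn (f : Hardy) : DifferentiableOn ℂ f bidisc :=
  f.memHardy.differentiableOn

end Hardy

lemma hasSum_sqMean {f : ℂ × ℂ → ℂ} (hf : DifferentiableOn ℂ f bidisc) {t : ℝ}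
    (ht : t ∈ Ico (0 : ℝ) 1) :
    HasSum (fun p : ℕ × ℕ => ‖taylorCoeff f p‖ ^ 2 * (t ^ (p.1 + p.2)) ^ 2) (sqMean f t) := by
  have h := hasSum_integral hf hf ht
  rw [← Complex.hasSum_ofReal]
  convert h using 1
  · ext p
    rw [Complex.conj_mul']
    push_cast
    ring
  · unfold sqMean
    rw [← integral_complex_ofReal]
    congr 1
    ext x
    rw [Complex.conj_mul']
    push_cast
    rfl

lemma tendsto_pow_sq (n : ℕ) : Tendsto (fun t : ℝ => (t ^ n) ^ 2) (𝓝[<] 1) (𝓝 1) := by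
  have : Continuous fun t : ℝ => (t ^ n) ^ 2 := by fun_prop
  simpa using (this.tendsto 1).mono_left nhdsWithin_le_nhds

lemma eventually_mem : ∀ᶠ t in 𝓝[<] (1 : ℝ), t ∈ Ico (0 : ℝ) 1 :=
  Ico_mem_nhdsLT one_pos

lemma memlp_taylorCoeff (f : Hardy) : Memℓp (taylorCoeff f) 2 := by
  obtain ⟨C, hC⟩ := f.memHardy.bddAbove
  refine memℓp_gen ?_
  simp only [ENNReal.toReal_ofNat, Real.rpow_two]
  refine summable_of_sum_le (c := C) (fun _ => by positivity) fun u => ?_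
  have h1 : Tendsto (fun t : ℝ => ∑ p ∈ u, ‖taylorCoeff f p‖ ^ 2 * (t ^ (p.1 + p.2)) ^ 2)
      (𝓝[<] 1) (𝓝 (∑ p ∈ u, ‖taylorCoeff f p‖ ^ 2 * 1)) :=
    tendsto_finsetSum _ fun p _ => (tendsto_pow_sq _).const_mul _
  simp only [mul_one] at h1
  refine le_of_tendsto h1 ?_
  filter_upwards [eventually_mem] with t ht
  exact (sum_le_hasSum u (fun _ _ => by positivity) (hasSum_sqMean f.differentiableOn ht)).trans
    (hC (mem_image_of_mem _ ht))

lemma taylorCoeff_add (f g : Hardy) (p : ℕ × ℕ) :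
    taylorCoeff (f + g : Hardy) p = taylorCoeff f p + taylorCoeff g p := by
  have hi : ∀ h : Hardy, Integrable (fun x => UnitAddTorus.mFourier (-index p) x *
      h (torusPoint 2⁻¹ 2⁻¹ x)) torusMeasure := fun h =>
    ((UnitAddTorus.mFourier (-index p)).continuous.mul
      (continuous_slice h.differentiableOn half_mem half_mem)).integrable_of_hasCompactSupport
      (HasCompactSupport.of_compactSpace _)
  unfold taylorCoeff torusCoeff
  rw [← mul_add, ← integral_add (hi f) (hi g)]
  simp only [Hardy.add_apply, mul_add]

lemma taylorCoeff_smul (c : ℂ) (f : Hardy) (p : ℕ × ℕ) :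
    taylorCoeff (c • f : Hardy) p = c * taylorCoeff f p := by
  unfold taylorCoeff torusCoeff
  simp only [Hardy.smul_apply, mul_left_comm _ c, integral_const_mul]

/-- The sequence of Taylor coefficients. -/
def coeffMap : Hardy →ₗ[ℂ] lp (fun _ : ℕ × ℕ => ℂ) 2 where
  toFun f := ⟨taylorCoeff f, memlp_taylorCoeff f⟩
  map_add' f g := by ext p; exact taylorCoeff_add f g p
  map_smul' c f := by ext p; exact taylorCoeff_smul c f p

lemma coeffMap_apply (f : Hardy) (p : ℕ × ℕ) : coeffMap f p = taylorCoeff f p := rfl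

lemma tendsto_inner (f g : Hardy) :
    Tendsto (fun t : ℝ => ∫ x, conj (f (torusPoint t t x)) * g (torusPoint t t x) ∂torusMeasure)
      (𝓝[<] 1) (𝓝 (inner ℂ (coeffMap f) (coeffMap g))) := by
  have hs := lp.summable_inner (𝕜 := ℂ) (coeffMap f) (coeffMap g)
  rw [lp.inner_eq_tsum]
  have h := tendsto_tsum_of_dominated_convergence (𝓕 := 𝓝[<] (1 : ℝ))
    (f := fun (t : ℝ) (p : ℕ × ℕ) => (conj (taylorCoeff f p) * taylorCoeff g p) *
      ((t ^ (p.1 + p.2)) ^ 2 : ℝ)) (g := fun p => inner ℂ (coeffMap f p) (coeffMap g p))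
    hs.norm (fun p => ?_) ?_
  · refine h.congr' ?_
    filter_upwards [eventually_mem] with t ht
    exact (hasSum_integral f.differentiableOn g.differentiableOn ht).tsum_eq
  · have := (Complex.continuous_ofReal.tendsto 1).comp (tendsto_pow_sq (p.1 + p.2))
    simpa [coeffMap_apply, mul_comm] using this.const_mul (conj (taylorCoeff f p) * taylorCoeff g p)
  · filter_upwards [eventually_mem] with t ht p
    have h1 : |(t ^ (p.1 + p.2)) ^ 2| ≤ 1 := by
      rw [abs_of_nonneg (by positivity)]
      exact pow_le_one₀ (pow_nonneg ht.1 _) (pow_le_one₀ ht.1 ht.2.le)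
    rw [norm_mul, Complex.norm_real, Real.norm_eq_abs]
    refine (mul_le_of_le_one_right (norm_nonneg _) h1).trans (le_of_eq ?_)
    simp [coeffMap_apply, mul_comm]

lemma innerProd_eq (f g : Hardy) : f.innerProd g = inner ℂ (coeffMap f) (coeffMap g) :=
  (tendsto_inner f g).limUnder_eq

lemma norm_taylorCoeff_le (f : Hardy) (p : ℕ × ℕ) : ‖taylorCoeff f p‖ ≤ ‖coeffMap f‖ :=
  lp.norm_apply_le_norm (by norm_num) (coeffMap f) p

lemma Hardy.hasSum (f : Hardy) {z : ℂ × ℂ} (hz : z ∈ bidisc) :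
    HasSum (fun p : ℕ × ℕ => taylorCoeff f p * (z.1 ^ p.1 * z.2 ^ p.2)) (f z) :=
  hasSum_taylor f.differentiableOn (norm_taylorCoeff_le f) hz

lemma coeffMap_injective : Function.Injective coeffMap := by
  rw [← LinearMap.ker_eq_bot, LinearMap.ker_eq_bot']
  intro f hf
  ext z hz
  have h : ∀ p, taylorCoeff f p = 0 := fun p => by rw [← coeffMap_apply, hf]; rfl
  have := f.hasSum hz
  simp only [h, zero_mul] at this
  exact this.unique hasSum_zero

/-- The inner product turns the Hardy space into an inner product space. -/
@[reducible] def innerCore : InnerProductSpace.Core ℂ Hardy where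
  inner := Hardy.innerProd
  conj_inner_symm f g := by rw [innerProd_eq, innerProd_eq, inner_conj_symm]
  re_inner_nonneg f := by rw [innerProd_eq]; exact inner_self_nonneg
  add_left f g h := by simp only [innerProd_eq, map_add, inner_add_left]
  smul_left f g c := by simp only [innerProd_eq, map_smul, inner_smul_left]
  definite f hf := by
    rw [innerProd_eq, inner_self_eq_zero] at hf
    exact coeffMap_injective (hf.trans (map_zero _).symm)

instance : NormedAddCommGroup Hardy := innerCore.toNormedAddCommGroup
instance : InnerProductSpace ℂ Hardy := InnerProductSpace.ofCore innerCore.toCore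

lemma Hardy.inner_def (f g : Hardy) : inner ℂ f g = limUnder (𝓝[<] (1 : ℝ)) fun t =>
    ∫ x, conj (f (torusPoint t t x)) * g (torusPoint t t x) ∂torusMeasure := rfl

lemma inner_coeffMap (f g : Hardy) : inner ℂ (coeffMap f) (coeffMap g) = inner ℂ f g :=
  (innerProd_eq f g).symm

lemma norm_coeffMap (f : Hardy) : ‖coeffMap f‖ = ‖f‖ := by
  rw [@norm_eq_sqrt_re_inner ℂ, inner_coeffMap, ← @norm_eq_sqrt_re_inner ℂ]

lemma tendsto_sqMean (f : Hardy) : Tendsto (sqMean f) (𝓝[<] 1) (𝓝 (‖f‖ ^ 2)) := by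
  have h := tendsto_inner f f
  rw [inner_coeffMap, inner_self_eq_norm_sq_to_K] at h
  have h' := (Complex.continuous_re.tendsto _).comp h
  have e : (((‖f‖ : ℝ) : ℂ) ^ 2).re = ‖f‖ ^ 2 := by rw [← Complex.ofReal_pow, Complex.ofReal_re]
  erw [e] at h'
  refine h'.congr fun t => ?_
  simp only [Function.comp_apply, Complex.conj_mul']
  have : ∀ x, ((‖f (torusPoint t t x)‖ : ℂ) ^ 2) = ((‖f (torusPoint t t x)‖ ^ 2 : ℝ) : ℂ) :=
    fun x => by push_cast; rfl
  simp_rw [this]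
  rw [integral_complex_ofReal, Complex.ofReal_re]
  rfl

lemma hasFDerivAt_monomial (a : ℂ) (p : ℕ × ℕ) (z : ℂ × ℂ) :
    HasFDerivAt (fun z : ℂ × ℂ => a * (z.1 ^ p.1 * z.2 ^ p.2))
      (a • (z.1 ^ p.1 • ((p.2 : ℂ) * z.2 ^ (p.2 - 1)) • ContinuousLinearMap.snd ℂ ℂ ℂ +
        z.2 ^ p.2 • ((p.1 : ℂ) * z.1 ^ (p.1 - 1)) • ContinuousLinearMap.fst ℂ ℂ ℂ)) z := by
  have h1 : HasFDerivAt (fun z : ℂ × ℂ => z.1 ^ p.1)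
      (((p.1 : ℂ) * z.1 ^ (p.1 - 1)) • ContinuousLinearMap.fst ℂ ℂ ℂ) z :=
    (hasDerivAt_pow p.1 z.1).comp_hasFDerivAt z hasFDerivAt_fst
  have h2 : HasFDerivAt (fun z : ℂ × ℂ => z.2 ^ p.2)
      (((p.2 : ℂ) * z.2 ^ (p.2 - 1)) • ContinuousLinearMap.snd ℂ ℂ ℂ) z :=
    (hasDerivAt_pow p.2 z.2).comp_hasFDerivAt z hasFDerivAt_snd
  exact (h1.mul h2).const_mul a

lemma summable_nat_mul_pow {r : ℝ} (hr : r ∈ Ico (0 : ℝ) 1) :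
    Summable fun n : ℕ => (n : ℝ) * r ^ (n - 1) := by
  rw [← summable_nat_add_iff 1]
  have h1 := summable_pow_mul_geometric_of_norm_lt_one (R := ℝ) 1
    (r := r) (by rw [Real.norm_eq_abs, abs_of_nonneg hr.1]; exact hr.2)
  refine (h1.add (summable_geometric_of_lt_one hr.1 hr.2)).congr fun n => ?_
  simp
  ring

/-- The sum of a power series with square summable coefficients, extended by zero. -/
def powerSum (a : ℕ × ℕ → ℂ) (z : ℂ × ℂ) : ℂ := by
  classical exact if z ∈ bidisc then ∑' p : ℕ × ℕ, a p * (z.1 ^ p.1 * z.2 ^ p.2) else 0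

lemma powerSum_of_mem (a : ℕ × ℕ → ℂ) {z : ℂ × ℂ} (hz : z ∈ bidisc) :
    powerSum a z = ∑' p : ℕ × ℕ, a p * (z.1 ^ p.1 * z.2 ^ p.2) := if_pos hz

lemma differentiableOn_powerSum {a : ℕ × ℕ → ℂ} {C : ℝ} (hC : ∀ p, ‖a p‖ ≤ C) :
    DifferentiableOn ℂ (powerSum a) bidisc := by
  have hC0 : 0 ≤ C := (norm_nonneg _).trans (hC (0, 0))
  refine DifferentiableOn.congr (f := fun z : ℂ × ℂ => ∑' p : ℕ × ℕ, a p * (z.1 ^ p.1 * z.2 ^ p.2))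
    ?_ fun z hz => powerSum_of_mem a hz
  intro z hz
  have hz1 : ‖z‖ < 1 := by
    rw [bidisc, ball_prod_same] at hz
    exact mem_ball_zero_iff.mp hz
  obtain ⟨r, hzr, hr1⟩ := exists_between hz1
  have hr : r ∈ Ico (0 : ℝ) 1 := ⟨(norm_nonneg z).trans hzr.le, hr1⟩
  have hu : Summable fun p : ℕ × ℕ =>
      C * (r ^ p.1 * ((p.2 : ℝ) * r ^ (p.2 - 1)) + ((p.1 : ℝ) * r ^ (p.1 - 1)) * r ^ p.2) := by
    have hg := summable_geometric_of_lt_one hr.1 hr.2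
    have hn := summable_nat_mul_pow hr
    have p1 : ∀ n : ℕ, 0 ≤ r ^ n := fun n => pow_nonneg hr.1 n
    have p2 : ∀ n : ℕ, 0 ≤ (n : ℝ) * r ^ (n - 1) := fun n => mul_nonneg n.cast_nonneg (p1 _)
    exact ((hg.mul_of_nonneg hn p1 p2).add (hn.mul_of_nonneg hg p2 p1)).mul_left C
  refine (hasFDerivAt_tsum_of_isPreconnected hu (Metric.isOpen_ball (x := (0 : ℂ × ℂ)) (ε := r))
    (convex_ball _ _).isPreconnected (fun p y _ => hasFDerivAt_monomial (a p) p y) ?_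
    (x₀ := 0) (Metric.mem_ball_self ((norm_nonneg z).trans_lt hzr)) ?_
    (mem_ball_zero_iff.mpr hzr)).differentiableAt.differentiableWithinAt
  · intro p y hy
    have hy' : ‖y‖ < r := mem_ball_zero_iff.mp hy
    have y1 : ‖y.1‖ ≤ r := (norm_fst_le y).trans hy'.le
    have y2 : ‖y.2‖ ≤ r := (norm_snd_le y).trans hy'.le
    rw [norm_smul]
    refine mul_le_mul (hC p) ?_ (norm_nonneg _) hC0
    refine (norm_add_le _ _).trans (add_le_add ?_ ?_)
    · rw [norm_smul, norm_smul, norm_mul, norm_pow, norm_pow, Complex.norm_natCast]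
      calc _ ≤ r ^ p.1 * ((p.2 : ℝ) * r ^ (p.2 - 1) * 1) := by
            have := ContinuousLinearMap.norm_snd_le ℂ ℂ ℂ
            have := hr.1
            gcongr
        _ = _ := by ring
    · rw [norm_smul, norm_smul, norm_mul, norm_pow, norm_pow, Complex.norm_natCast]
      calc _ ≤ r ^ p.2 * ((p.1 : ℝ) * r ^ (p.1 - 1) * 1) := by
            have := ContinuousLinearMap.norm_fst_le ℂ ℂ ℂ
            have := hr.1
            gcongr
        _ = _ := by ring
  · refine summable_of_ne_finset_zero (s := {(0, 0)}) fun p hp => ?_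
    have : p.1 ≠ 0 ∨ p.2 ≠ 0 := by
      by_contra! h
      exact hp (Finset.mem_singleton.mpr (Prod.ext h.1 h.2))
    rcases this with h | h <;> simp [h]

lemma taylorCoeff_powerSum {a : ℕ × ℕ → ℂ} {C : ℝ} (hC : ∀ p, ‖a p‖ ≤ C) (q : ℕ × ℕ) :
    taylorCoeff (powerSum a) q = a q := by
  classical
  have e : ∀ x, UnitAddTorus.mFourier (-index q) x * powerSum a (torusPoint 2⁻¹ 2⁻¹ x) =
      ∑' p : ℕ × ℕ, (a p * (2⁻¹ ^ p.1 * 2⁻¹ ^ p.2)) *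
        (UnitAddTorus.mFourier (-index q) x * UnitAddTorus.mFourier (index p) x) := by
    intro x
    rw [powerSum_of_mem _ (torusPoint_mem half_mem half_mem x), ← tsum_mul_left]
    congr 1
    ext p
    have : UnitAddTorus.mFourier (index p) x =
        (AddCircle.toCircle (x 0) : ℂ) ^ p.1 * (AddCircle.toCircle (x 1) : ℂ) ^ p.2 := by
      simp [UnitAddTorus.mFourier, index, AddCircle.toCircle_nsmul]
    rw [this]
    simp only [torusPoint, mul_pow]
    push_cast
    ring
  unfold taylorCoeff torusCoeff
  simp_rw [e]
  have hc : ∀ p : ℕ × ℕ, Continuous fun x => (a p * (2⁻¹ ^ p.1 * 2⁻¹ ^ p.2)) *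
        (UnitAddTorus.mFourier (-index q) x * UnitAddTorus.mFourier (index p) x) :=
    fun p => by fun_prop
  rw [← integral_tsum_of_summable_integral_norm
    (fun p => (hc p).integrable_of_hasCompactSupport (HasCompactSupport.of_compactSpace _))]
  · simp_rw [integral_const_mul, integral_mFourier]
    rw [tsum_eq_single q]
    · rw [if_pos rfl, mul_one, pow_add]
      have e1 : (2 : ℂ) ^ q.1 * 2⁻¹ ^ q.1 = 1 := by rw [← mul_pow]; norm_num
      have e2 : (2 : ℂ) ^ q.2 * 2⁻¹ ^ q.2 = 1 := by rw [← mul_pow]; norm_num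
      linear_combination a q * (2 : ℂ) ^ q.2 * 2⁻¹ ^ q.2 * e1 + a q * e2
    · intro p hp
      rw [if_neg fun h => hp (index_injective h).symm, mul_zero]
  · have hm : ∀ (k : Fin 2 → ℤ) x, ‖UnitAddTorus.mFourier k x‖ = 1 := fun k x => by
      simp [UnitAddTorus.mFourier, Circle.norm_coe]
    refine Summable.of_nonneg_of_le (fun p => integral_nonneg fun x => norm_nonneg _) (fun p => ?_)
      ((summable_geom half_mem half_mem).mul_left C)
    simp only [norm_mul, hm, mul_one, integral_const, probReal_univ, one_smul, norm_pow, norm_inv,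
      Complex.norm_ofNat]
    gcongr
    exact hC p

lemma coeffMap_surjective : Function.Surjective coeffMap := by
  intro a
  have hC : ∀ p, ‖a p‖ ≤ ‖a‖ := fun p => lp.norm_apply_le_norm (by norm_num) a p
  have hd := differentiableOn_powerSum hC
  refine ⟨Hardy.mk (powerSum a) ⟨hd, fun z hz => if_neg hz, ∑' p, ‖a p‖ ^ 2, ?_⟩, ?_⟩
  · rintro _ ⟨t, ht, rfl⟩
    have h := hasSum_sqMean hd ht
    simp only [taylorCoeff_powerSum hC] at h
    have hs : Summable fun p => ‖a p‖ ^ 2 := by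
      simpa using (lp.memℓp a).summable (by norm_num)
    refine hasSum_le (fun p => ?_) h hs.hasSum
    refine mul_le_of_le_one_right (by positivity) ?_
    exact pow_le_one₀ (pow_nonneg ht.1 _) (pow_le_one₀ ht.1 ht.2.le)
  · ext p
    exact taylorCoeff_powerSum hC p

/-- Taylor coefficients identify the Hardy space with the square summable double sequences. -/
def coeffEquiv : Hardy ≃ₗᵢ[ℂ] lp (fun _ : ℕ × ℕ => ℂ) 2 where
  toLinearEquiv := LinearEquiv.ofBijective coeffMap ⟨coeffMap_injective, coeffMap_surjective⟩
  norm_map' := norm_coeffMap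

instance : CompleteSpace Hardy :=
  (completeSpace_congr (e := coeffEquiv.toEquiv) coeffEquiv.isometry.isUniformEmbedding).mpr
    inferInstance

/-- Pointwise multiplication by a linear functional which is bounded by one on the bidisc. -/
def mulLin (c : ℂ × ℂ →L[ℂ] ℂ) (hc : ∀ p, ‖c p‖ ≤ ‖p‖) : Hardy →L[ℂ] Hardy :=
  have hle : ∀ (f : ℂ × ℂ → ℂ), DifferentiableOn ℂ f bidisc → ∀ t ∈ Ico (0 : ℝ) 1,
      sqMean (fun p => c p * f p) t ≤ sqMean f t := fun f hf t ht => by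
    refine integral_mono (integrable_sq (c.differentiable.differentiableOn.mul hf) ht)
      (integrable_sq hf ht) fun x => ?_
    have h1 : ‖c (torusPoint t t x)‖ ≤ 1 := by
      refine (hc _).trans ?_
      have := torusPoint_mem ht ht x
      rw [bidisc, ball_prod_same] at this
      exact (mem_ball_zero_iff.mp this).le
    simp only [norm_mul]
    gcongr
    exact mul_le_of_le_one_left (norm_nonneg _) h1
  LinearMap.mkContinuous
    { toFun := fun f => Hardy.mk (fun p => c p * f p)
        ⟨c.differentiable.differentiableOn.mul f.differentiableOn,
        fun p hp => by rw [f.memHardy.eq_zero p hp, mul_zero], by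
          obtain ⟨C, hC⟩ := f.memHardy.bddAbove
          refine ⟨C, ?_⟩
          rintro _ ⟨t, ht, rfl⟩
          exact (hle f f.differentiableOn t ht).trans (hC (mem_image_of_mem _ ht))⟩
      map_add' := fun f g => Hardy.ext fun p _ => mul_add _ _ _
      map_smul' := fun a f => Hardy.ext fun p _ => mul_left_comm _ _ _ } 1 fun f => by
    rw [one_mul]
    refine (sq_le_sq₀ (norm_nonneg _) (norm_nonneg _)).mp ?_
    refine le_of_tendsto_of_tendsto (tendsto_sqMean _) (tendsto_sqMean f) ?_
    filter_upwards [eventually_mem] with t ht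
    exact hle f f.differentiableOn t ht

/-- Multiplication by the first coordinate function. -/
def M₁ : Hardy →L[ℂ] Hardy := mulLin (ContinuousLinearMap.fst ℂ ℂ ℂ) norm_fst_le
/-- Multiplication by the second coordinate function. -/
def M₂ : Hardy →L[ℂ] Hardy := mulLin (ContinuousLinearMap.snd ℂ ℂ ℂ) norm_snd_le

lemma M₁_apply (f : Hardy) (p : ℂ × ℂ) : M₁ f p = p.1 * f p := rfl
lemma M₂_apply (f : Hardy) (p : ℂ × ℂ) : M₂ f p = p.2 * f p := rfl

/-- The compression `P_Q T|_Q` of an operator to a closed subspace `Q`. -/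
def compression (Q : Submodule ℂ Hardy) [CompleteSpace Q] (T : Hardy →L[ℂ] Hardy) : Q →L[ℂ] Q :=
  Q.orthogonalProjectionOnto ∘L T ∘L Q.subtypeL

/-- Quotient modules: closed subspaces invariant under the adjoints of both multiplications. -/
def IsQuotientModule (Q : Submodule ℂ Hardy) : Prop :=
  IsClosed (Q : Set Hardy) ∧ (∀ f ∈ Q, ContinuousLinearMap.adjoint M₁ f ∈ Q) ∧ ∀ f ∈ Q, ContinuousLinearMap.adjoint M₂ f ∈ Q

/-- A quotient module `Q` with `Q₁ Q₂ Q₂* = Q₂* Q₁ Q₂`, where `Q₁, Q₂` are the compressions of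
`M₁, M₂` to `Q`. -/
structure IsPhiDoublyCommuting (Q : Submodule ℂ Hardy) [CompleteSpace Q] : Prop where
  quotientModule : IsQuotientModule Q
  comm : compression Q M₁ ∘L compression Q M₂ ∘L ContinuousLinearMap.adjoint (compression Q M₂) =
    ContinuousLinearMap.adjoint (compression Q M₂) ∘L compression Q M₁ ∘L compression Q M₂

/-- The subspace `q H²` of all products of `q` with a function in the Hardy space, for a bounded
holomorphic function `q` on the bidisc. -/
def mulHardy (q : ℂ × ℂ → ℂ) : Submodule ℂ Hardy where
  carrier := {g | ∃ h : Hardy, ∀ p ∈ bidisc, g p = q p * h p}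
  zero_mem' := ⟨0, fun p _ => (mul_zero _).symm⟩
  add_mem' := by
    rintro f g ⟨h, hh⟩ ⟨k, hk⟩
    exact ⟨h + k, fun p hp => by simp [hh p hp, hk p hp, mul_add]⟩
  smul_mem' := by
    rintro c f ⟨h, hh⟩
    exact ⟨c • h, fun p hp => by simp [hh p hp, mul_left_comm]⟩

/-- Inner functions on the unit disc: bounded holomorphic functions whose radial limits exist and
have modulus one at almost every point of the unit circle. -/
structure IsInner (θ : ℂ → ℂ) : Prop where
  differentiableOn : DifferentiableOn ℂ θ (Metric.ball 0 1)
  bounded : ∃ C : ℝ, ∀ z ∈ Metric.ball (0 : ℂ) 1, ‖θ z‖ ≤ C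
  radial : ∀ᵐ x : UnitAddCircle ∂AddCircle.haarAddCircle, ∃ l : ℂ, ‖l‖ = 1 ∧
    Tendsto (fun r : ℝ => θ ((r : ℂ) * (AddCircle.toCircle x : ℂ))) (𝓝[<] 1) (𝓝 l)

end BidiscHardy
end

noncomputable section

namespace BidiscHardy

open Set Filter Topology MeasureTheory
open scoped ComplexConjugate ENNReal
open ContinuousLinearMap (adjoint)

/-! Let `V` be multiplication by `q = θ₁(z) θ₂(w)`. Since `q` has boundary modulus one, `V` is an
isometry (`adjoint_mulOp_mulOp`), so the quotient module is `ker V*` and its projection is `1 - V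
V*`. As `M₁` preserves `q H²` and `M₂*` preserves the quotient, the commutation relation becomes the
identity `CommutesOnKer` between operators on the full Hardy space (`isPhiDoublyCommuting_iff`). If
`V` is a unimodular multiple of `M₁ M₂`, then `V V*` fixes the range of `M₁ M₂` and both sides
vanish.

Conversely, test the identity on explicit functions. For `f = 1 / (1 - conj a z)`, the kernel at
`(a, 0)`, it reads `M₁ f = M₂* V G` with `G = V* M₁ M₂ f`; because `θ₁(a) = 0`, `G` depends on `w`
only. Hence `z / (1 - conj a z)` is a constant multiple of `θ₁`; evaluation at `a` forces `a = 0`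
and `θ₁ = c z` (`exists_eq_mul_fst`).

Then `V = c M₁ W`, with `W` multiplication by `θ₂(w)`, and every function of `w` alone is in `ker
V*`. Testing on `1` and `w` gives `1 = M₂* W W* w` and `W W* w = M₂* W W* w²`. Put `φ = (θ₂ - θ₂(0))
/ w`. These relations yield `1 = conj φ(0) φ + conj θ₂(0) θ₂` and `conj θ₂(0) φ(0) = 0`. The zero
`b` excludes `φ(0) = 0`, so `θ₂(0) = 0` and `θ₂` is a multiple of `w` (`exists_eq_mul_snd`). -/

/-! ### Multiplication by inner functions of the bidisc. -/

/-- Bounded holomorphic functions on the bidisc whose radial limits have modulus one almost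
everywhere on the torus. -/
structure IsInnerBidisc (q : ℂ × ℂ → ℂ) : Prop where
  differentiableOn : DifferentiableOn ℂ q bidisc
  bounded : ∃ C : ℝ, ∀ p ∈ bidisc, ‖q p‖ ≤ C
  radial : ∀ᵐ x ∂torusMeasure,
    Tendsto (fun t : ℝ => ‖q (torusPoint t t x)‖) (𝓝[<] 1) (𝓝 1)

lemma sqMean_mul_le {q f : ℂ × ℂ → ℂ} (hq : DifferentiableOn ℂ q bidisc) {C : ℝ}
    (hC : ∀ p ∈ bidisc, ‖q p‖ ≤ C) (hf : DifferentiableOn ℂ f bidisc) {t : ℝ}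
    (ht : t ∈ Ico (0 : ℝ) 1) : sqMean (fun p => q p * f p) t ≤ C ^ 2 * sqMean f t := by
  unfold sqMean
  rw [← integral_const_mul]
  refine integral_mono (integrable_sq (hq.mul hf) ht) ((integrable_sq hf ht).const_mul _)
    fun x => ?_
  have := hC _ (torusPoint_mem ht ht x)
  simp only [norm_mul, mul_pow]
  gcongr

lemma memHardy_mul {q : ℂ × ℂ → ℂ} (hq : DifferentiableOn ℂ q bidisc)
    (hb : ∃ C : ℝ, ∀ p ∈ bidisc, ‖q p‖ ≤ C) (f : Hardy) : MemHardy fun p => q p * f p := by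
  obtain ⟨C, hC⟩ := hb
  obtain ⟨D, hD⟩ := f.memHardy.bddAbove
  refine ⟨hq.mul f.differentiableOn, fun p hp => by rw [f.memHardy.eq_zero p hp, mul_zero],
    C ^ 2 * D, ?_⟩
  rintro _ ⟨t, ht, rfl⟩
  exact (sqMean_mul_le hq hC f.differentiableOn ht).trans
    (mul_le_mul_of_nonneg_left (hD (mem_image_of_mem _ ht)) (sq_nonneg C))

/-- Multiplication by a function which is inner on the bidisc. -/
def mulOp {q : ℂ × ℂ → ℂ} (hq : IsInnerBidisc q) : Hardy →L[ℂ] Hardy :=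
  LinearMap.mkContinuous
    { toFun := fun f => Hardy.mk _ (memHardy_mul hq.differentiableOn hq.bounded f)
      map_add' := fun f g => Hardy.ext fun p _ => mul_add _ _ _
      map_smul' := fun a f => Hardy.ext fun p _ => mul_left_comm _ _ _ }
    hq.bounded.choose fun f => by
    have hC := hq.bounded.choose_spec
    have hC0 : 0 ≤ hq.bounded.choose := (norm_nonneg _).trans
      (hC 0 ⟨Metric.mem_ball_self one_pos, Metric.mem_ball_self one_pos⟩)
    refine (sq_le_sq₀ (norm_nonneg _) (mul_nonneg hC0 (norm_nonneg _))).mp ?_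
    rw [mul_pow]
    refine le_of_tendsto_of_tendsto (tendsto_sqMean _) ((tendsto_sqMean f).const_mul _) ?_
    filter_upwards [eventually_mem] with t ht
    exact sqMean_mul_le hq.differentiableOn hC f.differentiableOn ht

lemma mulOp_apply {q : ℂ × ℂ → ℂ} (hq : IsInnerBidisc q) (f : Hardy) (p : ℂ × ℂ) :
    mulOp hq f p = q p * f p := rfl

lemma tendsto_integral_inner (f g : Hardy) :
    Tendsto (fun t : ℝ => ∫ x, conj (f (torusPoint t t x)) * g (torusPoint t t x) ∂torusMeasure)
      (𝓝[<] 1) (𝓝 (inner ℂ f g)) := by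
  rw [← inner_coeffMap]
  exact tendsto_inner f g

/-- Boundedness of `f` and `g` permits dominated convergence on the tori, so no boundary values of
general Hardy functions are needed. Reproducing kernels are bounded, which suffices to deduce `V* V
= 1` later. -/
lemma inner_mulOp_of_bounded {q : ℂ × ℂ → ℂ} (hq : IsInnerBidisc q) {f g : Hardy}
    (hf : ∃ C : ℝ, ∀ p ∈ bidisc, ‖f p‖ ≤ C) (hg : ∃ C : ℝ, ∀ p ∈ bidisc, ‖g p‖ ≤ C) :
    inner ℂ (mulOp hq f) (mulOp hq g) = inner ℂ f g := by
  obtain ⟨A, hA⟩ := hf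
  obtain ⟨B, hB⟩ := hg
  obtain ⟨C, hC⟩ := hq.bounded
  refine sub_eq_zero.mp (tendsto_nhds_unique ((tendsto_integral_inner (mulOp hq f)
    (mulOp hq g)).sub (tendsto_integral_inner f g)) ?_)
  -- The two integrands differ by `(|q|² - 1) conj f g`, which is bounded and tends to zero almost
  -- everywhere on the torus.
  have hlim : Tendsto (fun t : ℝ => ∫ x, ((‖q (torusPoint t t x)‖ ^ 2 - 1 : ℝ) : ℂ) *
      (conj (f (torusPoint t t x)) * g (torusPoint t t x)) ∂torusMeasure) (𝓝[<] 1)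
      (𝓝 (∫ _, (0 : ℂ) ∂torusMeasure)) := by
    refine tendsto_integral_filter_of_dominated_convergence (fun _ => (C ^ 2 + 1) * (A * B)) ?_ ?_
      (integrable_const _) ?_
    · filter_upwards [eventually_mem] with t ht
      have h1 := continuous_slice hq.differentiableOn ht ht
      have h2 := continuous_slice f.differentiableOn ht ht
      have h3 := continuous_slice g.differentiableOn ht ht
      exact ((Complex.continuous_ofReal.comp ((h1.norm.pow 2).sub continuous_const)).mul
        ((Complex.continuous_conj.comp h2).mul h3)).aestronglyMeasurable
    · filter_upwards [eventually_mem] with t ht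
      refine ae_of_all _ fun x => ?_
      have hx := torusPoint_mem ht ht x
      have h1 := hC _ hx
      have h2 := hA _ hx
      have h3 := hB _ hx
      have h4 : |‖q (torusPoint t t x)‖ ^ 2 - 1| ≤ C ^ 2 + 1 := by
        have : ‖q (torusPoint t t x)‖ ^ 2 ≤ C ^ 2 := by gcongr
        rw [abs_le]
        constructor <;> nlinarith [sq_nonneg ‖q (torusPoint t t x)‖]
      have hA0 : 0 ≤ A := (norm_nonneg _).trans h2
      rw [norm_mul, norm_mul, Complex.norm_real, Real.norm_eq_abs, RCLike.norm_conj]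
      gcongr
    · filter_upwards [hq.radial] with x hx
      have h1 : Tendsto (fun t : ℝ => |‖q (torusPoint t t x)‖ ^ 2 - 1| * (A * B)) (𝓝[<] 1)
          (𝓝 0) := by
        have := (((hx.pow 2).sub_const 1).abs).mul_const (A * B)
        simpa using this
      refine squeeze_zero_norm' ?_ h1
      filter_upwards [eventually_mem] with t ht
      have hx := torusPoint_mem ht ht x
      have h2 := hA _ hx
      have h3 := hB _ hx
      have hA0 : 0 ≤ A := (norm_nonneg _).trans h2
      rw [norm_mul, norm_mul, Complex.norm_real, Real.norm_eq_abs, RCLike.norm_conj]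
      gcongr
  rw [integral_zero] at hlim
  refine hlim.congr' ?_
  filter_upwards [eventually_mem] with t ht
  have hi : ∀ u v : Hardy, Integrable (fun x => conj (u (torusPoint t t x)) *
      v (torusPoint t t x)) torusMeasure := fun u v =>
    ((Complex.continuous_conj.comp (continuous_slice u.differentiableOn ht ht)).mul
      (continuous_slice v.differentiableOn ht ht)).integrable_of_hasCompactSupport
      (HasCompactSupport.of_compactSpace _)
  rw [← integral_sub (hi _ _) (hi _ _)]
  refine integral_congr_ae (ae_of_all _ fun x => ?_)
  simp only [mulOp_apply, map_mul]
  push_cast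
  rw [← Complex.conj_mul']
  ring

/-! ### Reproducing kernels and the isometry property. -/

lemma zero_mem_bidisc : (0 : ℂ × ℂ) ∈ bidisc :=
  ⟨Metric.mem_ball_self one_pos, Metric.mem_ball_self one_pos⟩

lemma norm_conj_mul_lt {z w : ℂ} (hz : z ∈ Metric.ball (0 : ℂ) 1)
    (hw : w ∈ Metric.ball (0 : ℂ) 1) : ‖conj z * w‖ < 1 := by
  rw [mem_ball_zero_iff] at hz hw
  rw [norm_mul, RCLike.norm_conj]
  nlinarith [norm_nonneg z, norm_nonneg w]

lemma one_sub_conj_mul_ne_zero {z w : ℂ} (hz : z ∈ Metric.ball (0 : ℂ) 1)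
    (hw : w ∈ Metric.ball (0 : ℂ) 1) : 1 - conj z * w ≠ 0 := by
  intro h
  have := norm_conj_mul_lt hz hw
  rw [← sub_eq_zero.mp h, norm_one] at this
  exact lt_irrefl _ this

lemma memlp_kernel {z : ℂ × ℂ} (hz : z ∈ bidisc) :
    Memℓp (fun p : ℕ × ℕ => conj (z.1 ^ p.1 * z.2 ^ p.2)) 2 := by
  have h1 := mem_ball_zero_iff.mp hz.1
  have h2 := mem_ball_zero_iff.mp hz.2
  refine memℓp_gen ?_
  have := summable_geom (r := ‖z.1‖ ^ 2) (s := ‖z.2‖ ^ 2)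
    ⟨by positivity, pow_lt_one₀ (norm_nonneg _) h1 two_ne_zero⟩
    ⟨by positivity, pow_lt_one₀ (norm_nonneg _) h2 two_ne_zero⟩
  refine this.congr fun p => ?_
  simp [mul_pow, ← pow_mul, mul_comm]

/-- The reproducing kernel of the Hardy space at a point of the bidisc. -/
def kernel {z : ℂ × ℂ} (hz : z ∈ bidisc) : Hardy := coeffEquiv.symm ⟨_, memlp_kernel hz⟩

lemma coeffMap_kernel {z : ℂ × ℂ} (hz : z ∈ bidisc) :
    coeffMap (kernel hz) = ⟨_, memlp_kernel hz⟩ :=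
  coeffEquiv.apply_symm_apply _

/-- The kernel has the conjugate monomials at `z` as Taylor coefficients, so the `ℓ²` inner product
is the Taylor series of `f` at `z`. -/
lemma inner_kernel {z : ℂ × ℂ} (hz : z ∈ bidisc) (f : Hardy) :
    inner ℂ (kernel hz) f = f z := by
  rw [← inner_coeffMap, coeffMap_kernel, lp.inner_eq_tsum, ← (f.hasSum hz).tsum_eq]
  congr 1
  ext p
  simp [coeffMap_apply]

lemma kernel_apply {z w : ℂ × ℂ} (hz : z ∈ bidisc) (hw : w ∈ bidisc) :
    kernel hz w = (1 - conj z.1 * w.1)⁻¹ * (1 - conj z.2 * w.2)⁻¹ := by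
  have h1 := norm_conj_mul_lt hz.1 hw.1
  have h2 := norm_conj_mul_lt hz.2 hw.2
  have hs := (hasSum_geometric_of_norm_lt_one h1).mul (hasSum_geometric_of_norm_lt_one h2)
    (summable_mul_of_summable_norm (summable_norm_geometric_of_norm_lt_one h1)
      (summable_norm_geometric_of_norm_lt_one h2))
  refine ((kernel hz).hasSum hw).unique (hs.congr_fun fun p => ?_)
  rw [← coeffMap_apply, coeffMap_kernel]
  simp only [map_mul, map_pow, mul_pow]
  ring

lemma norm_inv_one_sub_conj_mul_le {z w : ℂ} (hz : z ∈ Metric.ball (0 : ℂ) 1)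
    (hw : w ∈ Metric.ball (0 : ℂ) 1) : ‖(1 - conj z * w)⁻¹‖ ≤ (1 - ‖z‖)⁻¹ := by
  rw [mem_ball_zero_iff] at hz hw
  rw [norm_inv]
  refine inv_anti₀ (sub_pos.mpr hz) ?_
  have h := norm_sub_norm_le (1 : ℂ) (conj z * w)
  rw [norm_one, norm_mul, RCLike.norm_conj] at h
  nlinarith [norm_nonneg z, norm_nonneg w]

lemma kernel_bounded {z : ℂ × ℂ} (hz : z ∈ bidisc) :
    ∃ C : ℝ, ∀ p ∈ bidisc, ‖kernel hz p‖ ≤ C := by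
  refine ⟨(1 - ‖z.1‖)⁻¹ * (1 - ‖z.2‖)⁻¹, fun p hp => ?_⟩
  rw [kernel_apply hz hp, norm_mul]
  have := mem_ball_zero_iff.mp hz.1
  exact mul_le_mul (norm_inv_one_sub_conj_mul_le hz.1 hp.1)
    (norm_inv_one_sub_conj_mul_le hz.2 hp.2) (norm_nonneg _) (inv_nonneg.mpr (by linarith))

/-- Pairing kernels with kernels gives `V* V K = K` by the bounded case. Since `V* V` is
self-adjoint, its action on any `f` can be moved onto the kernel at `z`, which recovers `f z`. -/
lemma adjoint_mulOp_mulOp {q : ℂ × ℂ → ℂ} (hq : IsInnerBidisc q) (f : Hardy) :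
    adjoint (mulOp hq) (mulOp hq f) = f := by
  have h : ∀ {w : ℂ × ℂ} (hw : w ∈ bidisc),
      adjoint (mulOp hq) (mulOp hq (kernel hw)) = kernel hw := by
    intro w hw
    ext z hz
    rw [← inner_kernel hz, ContinuousLinearMap.adjoint_inner_right,
      inner_mulOp_of_bounded hq (kernel_bounded hz) (kernel_bounded hw), inner_kernel]
  ext z hz
  rw [← inner_kernel hz, ContinuousLinearMap.adjoint_inner_right,
    ← ContinuousLinearMap.adjoint_inner_left, h hz, inner_kernel]

/-- Kernels are common eigenvectors of adjoint multipliers. In particular the kernel at a zero of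
`q` lies in the quotient module. -/
lemma adjoint_mulOp_kernel {q : ℂ × ℂ → ℂ} (hq : IsInnerBidisc q) {z : ℂ × ℂ} (hz : z ∈ bidisc) :
    adjoint (mulOp hq) (kernel hz) = conj (q z) • kernel hz := by
  refine ext_inner_right ℂ fun f => ?_
  rw [ContinuousLinearMap.adjoint_inner_left, inner_kernel, inner_smul_left, inner_kernel,
    mulOp_apply, RCLike.conj_conj]

lemma adjoint_comm {S T : Hardy →L[ℂ] Hardy} (h : ∀ k, S (T k) = T (S k)) (f : Hardy) :
    ContinuousLinearMap.adjoint S (ContinuousLinearMap.adjoint T f) =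
      ContinuousLinearMap.adjoint T (ContinuousLinearMap.adjoint S f) := by
  refine ext_inner_right ℂ fun k => ?_
  simp only [ContinuousLinearMap.adjoint_inner_left, h]

/-! ### One-variable inner functions and the adjoints of the coordinate multiplications. -/

lemma isInner_id : IsInner fun z => z where
  differentiableOn := differentiableOn_id
  bounded := ⟨1, fun z hz => (mem_ball_zero_iff.mp hz).le⟩
  radial := ae_of_all _ fun x => ⟨AddCircle.toCircle x, Circle.norm_coe _, by
    have : Continuous fun r : ℝ => (r : ℂ) * (AddCircle.toCircle x : ℂ) := by fun_prop
    simpa using (this.tendsto 1).mono_left nhdsWithin_le_nhds⟩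

lemma ae_torus_of_ae_circle {P : UnitAddCircle → Prop}
    (h : ∀ᵐ x ∂AddCircle.haarAddCircle, P x) (i : Fin 2) : ∀ᵐ x ∂torusMeasure, P (x i) :=
  (measurePreserving_eval (fun _ : Fin 2 => AddCircle.haarAddCircle (T := (1 : ℝ))) i
    ).quasiMeasurePreserving.ae h

lemma IsInner.isInnerBidisc_fst {θ : ℂ → ℂ} (h : IsInner θ) :
    IsInnerBidisc fun p => θ p.1 where
  differentiableOn := h.differentiableOn.comp differentiableOn_fst fun _ hp => hp.1
  bounded := h.bounded.imp fun _ hC _ hp => hC _ hp.1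
  radial := by
    filter_upwards [ae_torus_of_ae_circle h.radial 0] with x ⟨l, hl, hx⟩
    have := hx.norm
    rw [hl] at this
    exact this

lemma IsInner.isInnerBidisc_snd {θ : ℂ → ℂ} (h : IsInner θ) :
    IsInnerBidisc fun p => θ p.2 where
  differentiableOn := h.differentiableOn.comp differentiableOn_snd fun _ hp => hp.2
  bounded := h.bounded.imp fun _ hC _ hp => hC _ hp.2
  radial := by
    filter_upwards [ae_torus_of_ae_circle h.radial 1] with x ⟨l, hl, hx⟩
    have := hx.norm
    rw [hl] at this
    exact this

lemma IsInnerBidisc.mul {q r : ℂ × ℂ → ℂ} (hq : IsInnerBidisc q) (hr : IsInnerBidisc r) :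
    IsInnerBidisc fun p => q p * r p where
  differentiableOn := hq.differentiableOn.mul hr.differentiableOn
  bounded := by
    obtain ⟨C, hC⟩ := hq.bounded
    obtain ⟨D, hD⟩ := hr.bounded
    refine ⟨C * D, fun p hp => ?_⟩
    rw [norm_mul]
    exact mul_le_mul (hC p hp) (hD p hp) (norm_nonneg _) ((norm_nonneg _).trans (hC p hp))
  radial := by
    filter_upwards [hq.radial, hr.radial] with x h1 h2
    simpa using h1.mul h2

lemma M₁_eq_mulOp : M₁ = mulOp isInner_id.isInnerBidisc_fst := rfl
lemma M₂_eq_mulOp : M₂ = mulOp isInner_id.isInnerBidisc_snd := rfl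

lemma adjoint_M₁_M₁ (f : Hardy) : adjoint M₁ (M₁ f) = f :=
  adjoint_mulOp_mulOp isInner_id.isInnerBidisc_fst f

lemma adjoint_M₂_M₂ (f : Hardy) : adjoint M₂ (M₂ f) = f :=
  adjoint_mulOp_mulOp isInner_id.isInnerBidisc_snd f

lemma M₁_injective : Function.Injective M₁ := Function.LeftInverse.injective adjoint_M₁_M₁

lemma M₂_injective : Function.Injective M₂ := Function.LeftInverse.injective adjoint_M₂_M₂

/-- The backward shift formula: it is dual to the identity `K_(z,w) - K_(0,w) = conj z M₁ K_(z,w)`,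
read off from the closed form of the kernel. -/
lemma fst_mul_adjoint_M₁ (f : Hardy) {z w : ℂ} (h : (z, w) ∈ bidisc) :
    z * adjoint M₁ f (z, w) = f (z, w) - f (0, w) := by
  have h0 : ((0 : ℂ), w) ∈ bidisc := ⟨Metric.mem_ball_self one_pos, h.2⟩
  have e : kernel h - kernel h0 = conj z • M₁ (kernel h) := by
    rw [sub_eq_iff_eq_add]
    ext p hp
    have := one_sub_conj_mul_ne_zero h.1 hp.1
    simp only [Hardy.add_apply, Hardy.smul_apply, M₁_apply, kernel_apply h hp, kernel_apply h0 hp,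
      map_zero, zero_mul, sub_zero, inv_one]
    field_simp
    ring
  rw [← inner_kernel h f, ← inner_kernel h0 f, ← inner_sub_left, e, inner_smul_left,
    RCLike.conj_conj, ← ContinuousLinearMap.adjoint_inner_right, inner_kernel]

lemma snd_mul_adjoint_M₂ (f : Hardy) {z w : ℂ} (h : (z, w) ∈ bidisc) :
    w * adjoint M₂ f (z, w) = f (z, w) - f (z, 0) := by
  have h0 : (z, (0 : ℂ)) ∈ bidisc := ⟨h.1, Metric.mem_ball_self one_pos⟩
  have e : kernel h - kernel h0 = conj w • M₂ (kernel h) := by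
    rw [sub_eq_iff_eq_add]
    ext p hp
    have := one_sub_conj_mul_ne_zero h.2 hp.2
    simp only [Hardy.add_apply, Hardy.smul_apply, M₂_apply, kernel_apply h hp, kernel_apply h0 hp,
      map_zero, zero_mul, sub_zero, inv_one]
    field_simp
    ring
  rw [← inner_kernel h f, ← inner_kernel h0 f, ← inner_sub_left, e, inner_smul_left,
    RCLike.conj_conj, ← ContinuousLinearMap.adjoint_inner_right, inner_kernel]

/-- The kernel of `M₁*` consists of the functions of the second variable. Injectivity of `M₁`
removes the factor `z` in the backward shift formula, including at `z = 0`. -/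
lemma adjoint_M₁_eq_zero_iff {f : Hardy} :
    adjoint M₁ f = 0 ↔ ∀ p ∈ bidisc, f p = f (0, p.2) := by
  refine ⟨fun h p hp => ?_, fun h => M₁_injective (Hardy.ext fun p hp => ?_)⟩
  · have := fst_mul_adjoint_M₁ f hp
    rw [h, show (0 : Hardy) (p.1, p.2) = 0 from rfl, mul_zero] at this
    exact sub_eq_zero.mp this.symm
  · rw [M₁_apply, map_zero]
    exact (fst_mul_adjoint_M₁ f hp).trans (sub_eq_zero.mpr (h p hp))

lemma adjoint_M₂_eq_zero_iff {f : Hardy} :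
    adjoint M₂ f = 0 ↔ ∀ p ∈ bidisc, f p = f (p.1, 0) := by
  refine ⟨fun h p hp => ?_, fun h => M₂_injective (Hardy.ext fun p hp => ?_)⟩
  · have := snd_mul_adjoint_M₂ f hp
    rw [h, show (0 : Hardy) (p.1, p.2) = 0 from rfl, mul_zero] at this
    exact sub_eq_zero.mp this.symm
  · rw [M₂_apply, map_zero]
    exact (snd_mul_adjoint_M₂ f hp).trans (sub_eq_zero.mpr (h p hp))

lemma mulOp_comm {q r : ℂ × ℂ → ℂ} (hq : IsInnerBidisc q) (hr : IsInnerBidisc r) (f : Hardy) :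
    mulOp hq (mulOp hr f) = mulOp hr (mulOp hq f) :=
  Hardy.ext fun _ _ => mul_left_comm _ _ _

lemma adjoint_mulOp_comm {q r : ℂ × ℂ → ℂ} (hq : IsInnerBidisc q) (hr : IsInnerBidisc r)
    (f : Hardy) : adjoint (mulOp hq) (adjoint (mulOp hr) f) =
      adjoint (mulOp hr) (adjoint (mulOp hq) f) :=
  adjoint_comm (mulOp_comm hq hr) f

/-- Multiplication by a function of the first variable commutes with the adjoint of `M₂`. -/
lemma adjoint_M₂_mulOp_fst {θ : ℂ → ℂ} (h : IsInner θ) (f : Hardy) :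
    adjoint M₂ (mulOp h.isInnerBidisc_fst f) = mulOp h.isInnerBidisc_fst (adjoint M₂ f) := by
  set V := mulOp h.isInnerBidisc_fst with hV
  -- The component `f - M₂ M₂* f` depends on `z` only, and multiplication by a function of `z` keeps
  -- it so.
  have h0 : adjoint M₂ (V (f - M₂ (adjoint M₂ f))) = 0 := by
    have h1 : adjoint M₂ (f - M₂ (adjoint M₂ f)) = 0 := by
      rw [map_sub, adjoint_M₂_M₂, sub_self]
    rw [adjoint_M₂_eq_zero_iff] at h1 ⊢
    intro p hp
    rw [hV, mulOp_apply, mulOp_apply, h1 p hp]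
  rw [map_sub, map_sub, sub_eq_zero] at h0
  rw [h0, hV, M₂_eq_mulOp, mulOp_comm, ← M₂_eq_mulOp, adjoint_M₂_M₂]

/-- Multiplication by a function of the second variable commutes with the adjoint of `M₁`. -/
lemma adjoint_M₁_mulOp_snd {θ : ℂ → ℂ} (h : IsInner θ) (f : Hardy) :
    adjoint M₁ (mulOp h.isInnerBidisc_snd f) = mulOp h.isInnerBidisc_snd (adjoint M₁ f) := by
  set V := mulOp h.isInnerBidisc_snd with hV
  have h0 : adjoint M₁ (V (f - M₁ (adjoint M₁ f))) = 0 := by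
    have h1 : adjoint M₁ (f - M₁ (adjoint M₁ f)) = 0 := by
      rw [map_sub, adjoint_M₁_M₁, sub_self]
    rw [adjoint_M₁_eq_zero_iff] at h1 ⊢
    intro p hp
    rw [hV, mulOp_apply, mulOp_apply, h1 p hp]
  rw [map_sub, map_sub, sub_eq_zero] at h0
  rw [h0, hV, M₁_eq_mulOp, mulOp_comm, ← M₁_eq_mulOp, adjoint_M₁_M₁]

/-! ### The projection onto the quotient module and its compressions. -/

lemma mem_mulHardy_iff {q : ℂ × ℂ → ℂ} (hq : IsInnerBidisc q) {f : Hardy} :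
    f ∈ mulHardy q ↔ ∃ h, mulOp hq h = f :=
  ⟨fun ⟨h, hh⟩ => ⟨h, Hardy.ext fun p hp => (hh p hp).symm⟩, fun ⟨h, hh⟩ => ⟨h, fun p _ => by
    rw [← hh, mulOp_apply]⟩⟩

lemma mem_mulHardy_orthogonal_iff {q : ℂ × ℂ → ℂ} (hq : IsInnerBidisc q) {f : Hardy} :
    f ∈ (mulHardy q)ᗮ ↔ adjoint (mulOp hq) f = 0 := by
  rw [Submodule.mem_orthogonal]
  constructor
  · intro h
    refine ext_inner_left ℂ fun k => ?_
    rw [inner_zero_right, ContinuousLinearMap.adjoint_inner_right]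
    exact h _ ((mem_mulHardy_iff hq).mpr ⟨k, rfl⟩)
  · rintro h _ hu
    obtain ⟨k, rfl⟩ := (mem_mulHardy_iff hq).mp hu
    rw [← ContinuousLinearMap.adjoint_inner_right, h, inner_zero_right]

/-- For an isometry `V`, the operator `V V*` is the orthogonal projection onto the range of `V`,
which is `q H²`. -/
lemma coe_orthogonalProjectionOnto {q : ℂ × ℂ → ℂ} (hq : IsInnerBidisc q) (f : Hardy) :
    ((mulHardy q)ᗮ.orthogonalProjectionOnto f : Hardy) =
      f - mulOp hq (adjoint (mulOp hq) f) := by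
  refine Submodule.eq_starProjection_of_mem_orthogonal
    ((mem_mulHardy_orthogonal_iff hq).mpr ?_) ?_
  · rw [map_sub, adjoint_mulOp_mulOp, sub_self]
  · rw [sub_sub_cancel]
    exact Submodule.le_orthogonal_orthogonal _ ((mem_mulHardy_iff hq).mpr ⟨_, rfl⟩)

lemma isQuotientModule_mulHardy_orthogonal {q : ℂ × ℂ → ℂ} (hq : IsInnerBidisc q) :
    IsQuotientModule (mulHardy q)ᗮ := by
  refine ⟨Submodule.isClosed_orthogonal _, fun f hf => ?_, fun f hf => ?_⟩ <;>
  · rw [mem_mulHardy_orthogonal_iff hq] at hf ⊢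
    simp only [M₁_eq_mulOp, M₂_eq_mulOp]
    rw [adjoint_mulOp_comm, hf, map_zero]

/-- Invariance of the quotient module under `M₂*` makes the outer projection superfluous. -/
lemma coe_adjoint_compression_M₂ {q : ℂ × ℂ → ℂ} (hq : IsInnerBidisc q) (f : (mulHardy q)ᗮ) :
    (adjoint (compression (mulHardy q)ᗮ M₂) f : Hardy) = adjoint M₂ f := by
  have h : adjoint M₂ (f : Hardy) ∈ (mulHardy q)ᗮ :=
    (isQuotientModule_mulHardy_orthogonal hq).2.2 _ f.2
  refine congrArg Subtype.val (a₂ := (⟨_, h⟩ : (mulHardy q)ᗮ)) ?_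
  refine ext_inner_right ℂ fun k => ?_
  rw [ContinuousLinearMap.adjoint_inner_left, compression, ContinuousLinearMap.comp_apply,
    Submodule.inner_orthogonalProjectionOnto_eq_of_mem_left, Submodule.coe_inner,
    ContinuousLinearMap.adjoint_inner_left]
  rfl

lemma coe_compression {q : ℂ × ℂ → ℂ} (hq : IsInnerBidisc q) (T : Hardy →L[ℂ] Hardy)
    (f : (mulHardy q)ᗮ) :
    (compression (mulHardy q)ᗮ T f : Hardy) = T f - mulOp hq (adjoint (mulOp hq) (T f)) :=
  coe_orthogonalProjectionOnto hq _

/-- The part of `M₂ f` removed by the inner projection lies in `q H²`; `M₁` keeps it there, so the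
outer projection kills it and a single projection remains. -/
lemma coe_compression_M₁_M₂ {q : ℂ × ℂ → ℂ} (hq : IsInnerBidisc q) (f : (mulHardy q)ᗮ) :
    (compression (mulHardy q)ᗮ M₁ (compression (mulHardy q)ᗮ M₂ f) : Hardy) =
      M₁ (M₂ f) - mulOp hq (adjoint (mulOp hq) (M₁ (M₂ f))) := by
  rw [coe_compression hq, coe_compression hq]
  have e : ∀ h, M₁ (mulOp hq h) = mulOp hq (M₁ h) := fun h =>
    mulOp_comm isInner_id.isInnerBidisc_fst hq h
  simp only [map_sub, e, adjoint_mulOp_mulOp]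
  abel

/-- The identity characterizing `φ`-double commutativity of the complement of the range of `V`. -/
def CommutesOnKer (V : Hardy →L[ℂ] Hardy) : Prop :=
  ∀ f : Hardy, adjoint V f = 0 →
    M₁ (M₂ (adjoint M₂ f)) - V (adjoint V (M₁ (M₂ (adjoint M₂ f)))) =
      adjoint M₂ (M₁ (M₂ f) - V (adjoint V (M₁ (M₂ f))))

/-- The defining identity of a `φ`-doubly commuting quotient module in terms of the isometry of
multiplication by `q`. -/
lemma isPhiDoublyCommuting_iff {q : ℂ × ℂ → ℂ} (hq : IsInnerBidisc q) :
    IsPhiDoublyCommuting (mulHardy q)ᗮ ↔ CommutesOnKer (mulOp hq) := by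
  have key : ∀ f : (mulHardy q)ᗮ,
      ((compression _ M₁ ∘L compression _ M₂ ∘L adjoint (compression _ M₂)) f =
        (adjoint (compression _ M₂) ∘L compression _ M₁ ∘L compression _ M₂) f) ↔
      M₁ (M₂ (adjoint M₂ (f : Hardy))) -
          mulOp hq (adjoint (mulOp hq) (M₁ (M₂ (adjoint M₂ (f : Hardy))))) =
        adjoint M₂ (M₁ (M₂ (f : Hardy)) -
          mulOp hq (adjoint (mulOp hq) (M₁ (M₂ (f : Hardy))))) := by
    intro f
    rw [Subtype.ext_iff]
    simp only [ContinuousLinearMap.comp_apply, coe_compression_M₁_M₂ hq,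
      coe_adjoint_compression_M₂ hq]
  constructor
  · intro h f hf
    exact (key ⟨f, (mem_mulHardy_orthogonal_iff hq).mpr hf⟩).mp (by rw [h.comm])
  · intro h
    exact ⟨isQuotientModule_mulHardy_orthogonal hq, ContinuousLinearMap.ext fun f =>
      (key f).mpr (h f ((mem_mulHardy_orthogonal_iff hq).mp f.2))⟩

/-! ### Normalization of inner functions and commutation relations of the shifts. -/

/-- A single good boundary point suffices: along its radius `|c z|` tends to `|c|`. -/
lemma IsInner.norm_eq_one_of_eq_mul {θ : ℂ → ℂ} (h : IsInner θ) {c : ℂ}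
    (hc : ∀ z ∈ Metric.ball (0 : ℂ) 1, θ z = c * z) : ‖c‖ = 1 := by
  obtain ⟨x, l, hl, hx⟩ := h.radial.exists
  rw [← hl]
  have h1 : Continuous fun r : ℝ => ‖c * ((r : ℂ) * (AddCircle.toCircle x : ℂ))‖ := by fun_prop
  have h2 := (h1.tendsto 1).mono_left (nhdsWithin_le_nhds (s := Iio 1))
  simp only [Complex.ofReal_one, one_mul, norm_mul, Circle.norm_coe, mul_one] at h2
  refine tendsto_nhds_unique h2 (hx.norm.congr' ?_)
  filter_upwards [eventually_mem] with r hr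
  rw [hc _ (norm_mul_toCircle_lt hr x)]
  simp only [norm_mul, Circle.norm_coe, mul_one]

/-- The zero function would be `c z` with `c = 0`, contradicting `|c| = 1`. -/
lemma IsInner.exists_ne_zero {θ : ℂ → ℂ} (h : IsInner θ) :
    ∃ z ∈ Metric.ball (0 : ℂ) 1, θ z ≠ 0 := by
  by_contra! h0
  have := h.norm_eq_one_of_eq_mul (c := 0) fun z hz => by rw [h0 z hz, zero_mul]
  simp at this

/-- Multiplication by `θ₁(z) θ₂(w)`. -/
abbrev prodOp {θ₁ θ₂ : ℂ → ℂ} (h₁ : IsInner θ₁) (h₂ : IsInner θ₂) : Hardy →L[ℂ] Hardy :=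
  mulOp (h₁.isInnerBidisc_fst.mul h₂.isInnerBidisc_snd)

lemma M₁_M₂_comm (f : Hardy) : M₁ (M₂ f) = M₂ (M₁ f) :=
  mulOp_comm isInner_id.isInnerBidisc_fst isInner_id.isInnerBidisc_snd f

lemma adjoint_M₂_M₁ (f : Hardy) : adjoint M₂ (M₁ f) = M₁ (adjoint M₂ f) :=
  adjoint_M₂_mulOp_fst isInner_id f

lemma adjoint_M₁_M₂ (f : Hardy) : adjoint M₁ (M₂ f) = M₂ (adjoint M₁ f) :=
  adjoint_M₁_mulOp_snd isInner_id f

lemma adjoint_M₁_kernel {z : ℂ × ℂ} (hz : z ∈ bidisc) :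
    adjoint M₁ (kernel hz) = conj z.1 • kernel hz :=
  adjoint_mulOp_kernel isInner_id.isInnerBidisc_fst hz

lemma adjoint_M₂_kernel {z : ℂ × ℂ} (hz : z ∈ bidisc) :
    adjoint M₂ (kernel hz) = conj z.2 • kernel hz :=
  adjoint_mulOp_kernel isInner_id.isInnerBidisc_snd hz

/-! ### Necessity: testing the identity on kernels and low powers of `w`. -/

section Necessity

variable {θ₁ θ₂ : ℂ → ℂ} (h₁ : IsInner θ₁) (h₂ : IsInner θ₂)

/-- If `θ₁(a) = 0`, then `V* M₂ K = 0` for the reproducing kernel `K` at `(a, 0)`. -/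
lemma adjoint_prodOp_M₂_kernel {a : ℂ} (hp : (a, (0 : ℂ)) ∈ bidisc) (ha : θ₁ a = 0) :
    adjoint (prodOp h₁ h₂) (M₂ (kernel hp)) = 0 := by
  refine ext_inner_right ℂ fun h => ?_
  have e : prodOp h₁ h₂ h = mulOp h₁.isInnerBidisc_fst (mulOp h₂.isInnerBidisc_snd h) :=
    Hardy.ext fun p _ => mul_assoc _ _ _
  -- Moving all operators to the other side gives the value of `M₂* V h` at `(a, 0)`; the factor
  -- `θ₁(z)` passes through `M₂*` and vanishes there.
  rw [ContinuousLinearMap.adjoint_inner_left, ← ContinuousLinearMap.adjoint_inner_right,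
    inner_kernel, e, adjoint_M₂_mulOp_fst h₁, mulOp_apply, ha, zero_mul, inner_zero_left]

/-- The kernel at `(a, 0)` is a function of `z` only, annihilated by both `M₂*` and `V*`, so only
one term of the identity involves `V`. -/
lemma exists_eq_mul_fst (H : CommutesOnKer (prodOp h₁ h₂))
    (hz : ∃ a ∈ Metric.ball (0 : ℂ) 1, θ₁ a = 0) :
    ∃ c : ℂ, ∀ z ∈ Metric.ball (0 : ℂ) 1, θ₁ z = c * z := by
  obtain ⟨a, ha, ha0⟩ := hz
  have hp : (a, (0 : ℂ)) ∈ bidisc := ⟨ha, Metric.mem_ball_self one_pos⟩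
  set f := kernel hp with hf
  set G := adjoint (prodOp h₁ h₂) (M₁ (M₂ f)) with hG
  have hf2 : adjoint M₂ f = 0 := by
    rw [hf, adjoint_M₂_kernel, map_zero, zero_smul]
  have hfV : adjoint (prodOp h₁ h₂) f = 0 := by
    rw [hf, adjoint_mulOp_kernel]
    simp only [ha0, zero_mul, map_zero, zero_smul]
  -- The left side vanishes and `M₂* M₂ = 1`, leaving `M₁ f = M₂* V G`.
  have hE := H f hfV
  rw [hf2, map_zero, map_zero, map_zero, map_zero, sub_zero, map_sub, M₁_M₂_comm,
    adjoint_M₂_M₂, ← M₁_M₂_comm, ← hG, eq_comm, sub_eq_zero] at hE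
  -- `M₁*` commutes with `V*` and cancels `M₁`, leaving `V* M₂ f = 0`. Thus `G` is a function of
  -- `w`.
  have hG1 : adjoint M₁ G = 0 := by
    rw [hG, M₁_eq_mulOp, adjoint_mulOp_comm, ← M₁_eq_mulOp, adjoint_M₁_M₁,
      adjoint_prodOp_M₂_kernel h₁ h₂ hp ha0]
  rw [adjoint_M₁_eq_zero_iff] at hG1
  have hhalf : (2⁻¹ : ℂ) ∈ Metric.ball (0 : ℂ) 1 := by
    rw [mem_ball_zero_iff, norm_inv, Complex.norm_ofNat]; norm_num
  -- Slice at `w = 1/2`; any nonzero `w` in the disc would serve, since the backward shift formula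
  -- carries a factor `w`.
  set C := θ₂ 2⁻¹ * G (0, 2⁻¹) - θ₂ 0 * G (0, 0)
  have key : ∀ z ∈ Metric.ball (0 : ℂ) 1, 2⁻¹ * (z * (1 - conj a * z)⁻¹) = θ₁ z * C := by
    intro z hz
    have hz1 : (z, (2⁻¹ : ℂ)) ∈ bidisc := ⟨hz, hhalf⟩
    have hz0 : (z, (0 : ℂ)) ∈ bidisc := ⟨hz, Metric.mem_ball_self one_pos⟩
    have h := snd_mul_adjoint_M₂ (prodOp h₁ h₂ G) hz1
    rw [← hE, M₁_apply, hf, kernel_apply hp hz1, mulOp_apply, mulOp_apply, hG1 _ hz1,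
      hG1 _ hz0] at h
    simp only [map_zero, zero_mul, sub_zero, inv_one, mul_one] at h
    rw [h]
    ring
  -- At `z = a` the right side vanishes, while the kernel factor on the left does not.
  have ha' : a = 0 := by
    have h := key a ha
    rw [ha0, zero_mul] at h
    simpa [one_sub_conj_mul_ne_zero ha ha] using h
  subst ha'
  simp only [map_zero, zero_mul, sub_zero, inv_one, mul_one] at key
  have hC : C ≠ 0 := by
    intro h0
    have := key _ hhalf
    rw [h0] at this
    norm_num at this
  refine ⟨2⁻¹ * C⁻¹, fun z hz => ?_⟩
  rw [mul_right_comm, key z hz, mul_assoc, mul_inv_cancel₀ hC, mul_one]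

lemma kernel_zero_apply {p : ℂ × ℂ} (hp : p ∈ bidisc) : kernel zero_mem_bidisc p = 1 := by
  simp [kernel_apply zero_mem_bidisc hp]

/-- A function in the kernel of `M₁*` is a constant plus a multiple of the second coordinate if
its image under `M₂*` is constant. -/
lemma eq_smul_add_of_adjoint {g k : Hardy} (h₁ : adjoint M₁ g = 0) (h₂ : adjoint M₂ g = k) :
    g = g 0 • kernel zero_mem_bidisc + M₂ k := by
  ext p hp
  have h := snd_mul_adjoint_M₂ g hp
  have e := adjoint_M₁_eq_zero_iff.mp h₁ (p.1, 0) ⟨hp.1, Metric.mem_ball_self one_pos⟩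
  rw [e, h₂] at h
  rw [Hardy.add_apply, Hardy.smul_apply, kernel_zero_apply hp, M₂_apply, mul_one]
  change _ = g (0, 0) + p.2 * k (p.1, p.2)
  rw [h]
  exact (add_sub_cancel _ _).symm

/-- With `θ₁ = c z`, the factor `M₁` can be cancelled and the identity becomes a statement about `W
W*` on functions of `w`, tested on `1` and `w`. -/
lemma exists_eq_mul_snd (H : CommutesOnKer (prodOp h₁ h₂)) {c : ℂ}
    (hc : ∀ z ∈ Metric.ball (0 : ℂ) 1, θ₁ z = c * z)
    (hz : ∃ b ∈ Metric.ball (0 : ℂ) 1, θ₂ b = 0) :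
    ∃ c : ℂ, ∀ w ∈ Metric.ball (0 : ℂ) 1, θ₂ w = c * w := by
  obtain ⟨b, hb, hb0⟩ := hz
  have hcn := h₁.norm_eq_one_of_eq_mul hc
  set W := mulOp h₂.isInnerBidisc_snd with hW
  set u := kernel zero_mem_bidisc with hu
  have hV : ∀ f, prodOp h₁ h₂ f = c • M₁ (W f) := fun f => Hardy.ext fun p hp => by
    rw [mulOp_apply, Hardy.smul_apply, M₁_apply, hW, mulOp_apply, hc _ hp.1]
    ring
  have hVa : ∀ f, adjoint (prodOp h₁ h₂) f = conj c • adjoint W (adjoint M₁ f) := fun f => by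
    refine ext_inner_right ℂ fun k => ?_
    rw [ContinuousLinearMap.adjoint_inner_left, hV, inner_smul_right, inner_smul_left,
      RCLike.conj_conj, ContinuousLinearMap.adjoint_inner_left,
      ContinuousLinearMap.adjoint_inner_left]
  -- The scalars combine to `|c|² = 1` and `M₁* M₁ = 1`.
  have hVV : ∀ f, prodOp h₁ h₂ (adjoint (prodOp h₁ h₂) (M₁ f)) = M₁ (W (adjoint W f)) :=
    fun f => by
    rw [hVa, adjoint_M₁_M₁, hV, map_smul, map_smul, smul_smul, Complex.mul_conj', hcn]
    simp
  have hu1 : adjoint M₁ u = 0 := by rw [hu, adjoint_M₁_kernel]; simp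
  have hu2 : adjoint M₂ u = 0 := by rw [hu, adjoint_M₂_kernel]; simp
  have hWu : adjoint W u = conj (θ₂ 0) • u := adjoint_mulOp_kernel _ _
  have hW1 : ∀ f, adjoint M₁ (adjoint W f) = adjoint W (adjoint M₁ f) :=
    adjoint_mulOp_comm isInner_id.isInnerBidisc_fst h₂.isInnerBidisc_snd
  have hW2 : ∀ f, adjoint M₂ (adjoint W f) = adjoint W (adjoint M₂ f) :=
    adjoint_mulOp_comm isInner_id.isInnerBidisc_snd h₂.isInnerBidisc_snd
  have hW2' : ∀ f, W (M₂ f) = M₂ (W f) :=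
    mulOp_comm h₂.isInnerBidisc_snd isInner_id.isInnerBidisc_snd
  set G₁ := adjoint W (M₂ u) with hG₁
  set G₂ := adjoint W (M₂ (M₂ u)) with hG₂
  have E1 : u = adjoint M₂ (W G₁) := by
    have h := H u (by rw [hVa, hu1, map_zero, smul_zero])
    rw [hu2, map_zero, map_zero, map_zero, map_zero, sub_zero, hVV, map_sub, adjoint_M₂_M₁,
      adjoint_M₂_M₁, adjoint_M₂_M₂, eq_comm, sub_eq_zero] at h
    exact M₁_injective h
  have E2 : W G₁ = adjoint M₂ (W G₂) := by
    have h := H (M₂ u) (by rw [hVa, adjoint_M₁_M₂, hu1, map_zero, map_zero, smul_zero])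
    rw [adjoint_M₂_M₂, hVV, hVV, map_sub, adjoint_M₂_M₁, adjoint_M₂_M₁, adjoint_M₂_M₂,
      sub_right_inj] at h
    exact M₁_injective h
  -- `W*` commutes with `M₂*`, so the backward shifts of `G₁` and `G₂` are `W* 1` and `G₁`.
  have e1 : G₁ = G₁ 0 • u + M₂ (conj (θ₂ 0) • u) := eq_smul_add_of_adjoint
    (by rw [hG₁, hW1, adjoint_M₁_M₂, hu1, map_zero, map_zero])
    (by rw [hG₁, hW2, adjoint_M₂_M₂, hWu])
  have e2 : G₂ = G₂ 0 • u + M₂ G₁ := eq_smul_add_of_adjoint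
    (by rw [hG₂, hW1, adjoint_M₁_M₂, adjoint_M₁_M₂, hu1, map_zero, map_zero, map_zero])
    (by rw [hG₂, hW2, adjoint_M₂_M₂])
  set φ := adjoint M₂ (W u) with hφ
  have hWu_apply : ∀ p ∈ bidisc, W u p = θ₂ p.2 := fun p hp => by
    rw [hW, mulOp_apply, hu, kernel_zero_apply hp, mul_one]
  have v1 : G₁ 0 = conj (φ 0) := by
    rw [← inner_kernel zero_mem_bidisc, ← inner_kernel zero_mem_bidisc, ← hu, hG₁, hφ,
      ContinuousLinearMap.adjoint_inner_right, ContinuousLinearMap.adjoint_inner_right,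
      inner_conj_symm]
  have v2 : G₂ 0 = conj (adjoint M₂ φ 0) := by
    rw [← inner_kernel zero_mem_bidisc, ← inner_kernel zero_mem_bidisc, ← hu, hG₂, hφ,
      ContinuousLinearMap.adjoint_inner_right, ContinuousLinearMap.adjoint_inner_right,
      ContinuousLinearMap.adjoint_inner_right, inner_conj_symm]
  have hφ_apply : ∀ w ∈ Metric.ball (0 : ℂ) 1, w * φ (0, w) = θ₂ w - θ₂ 0 := fun w hw => by
    have hp : ((0 : ℂ), w) ∈ bidisc := ⟨Metric.mem_ball_self one_pos, hw⟩
    rw [hφ, snd_mul_adjoint_M₂ _ hp, hWu_apply _ hp]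
    exact congrArg _ (hWu_apply _ zero_mem_bidisc)
  -- Inserting `e2` into `E2` cancels `W G₁` and leaves `G₂(0) φ = 0`. If `φ` were zero, `θ₂` would
  -- be constant, hence zero because of `b`.
  have hγ₂ : G₂ 0 = 0 := by
    rw [e2, map_add, map_add, map_smul, map_smul, hW2', adjoint_M₂_M₂, eq_comm, add_eq_right,
      smul_eq_zero] at E2
    refine E2.resolve_right fun h0 => ?_
    obtain ⟨w, hw, hw0⟩ := h₂.exists_ne_zero
    have hconst : ∀ w ∈ Metric.ball (0 : ℂ) 1, θ₂ w = θ₂ 0 := fun w hw => by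
      have := hφ_apply w hw
      rw [hφ, h0, show (0 : Hardy) (0, w) = 0 from rfl, mul_zero] at this
      exact sub_eq_zero.mp this.symm
    exact hw0 (by rw [hconst w hw, ← hconst b hb, hb0])
  have E3 : u = G₁ 0 • φ + conj (θ₂ 0) • W u := by
    conv_lhs => rw [E1, e1, map_add, map_add, map_smul, map_smul, hW2', adjoint_M₂_M₂, map_smul]
  -- Apply `M₂*` to `E3` and evaluate at the origin: the constant disappears, and `(M₂* φ)(0)` is
  -- the conjugate of `G₂(0) = 0`.
  have hprod : conj (θ₂ 0) * φ 0 = 0 := by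
    have h := congrArg (fun k => adjoint M₂ k 0) E3
    simp only [hu2, map_add, map_smul, Hardy.add_apply, Hardy.smul_apply] at h
    rw [← hφ, (map_eq_zero _).mp (v2.symm.trans hγ₂), mul_zero, zero_add] at h
    exact h.symm
  have E4 : ∀ w ∈ Metric.ball (0 : ℂ) 1,
      1 = conj (φ 0) * φ (0, w) + conj (θ₂ 0) * θ₂ w := fun w hw => by
    have hp : ((0 : ℂ), w) ∈ bidisc := ⟨Metric.mem_ball_self one_pos, hw⟩
    have h := congrArg (fun k : Hardy => k (0, w)) E3
    simp only [Hardy.add_apply, Hardy.smul_apply, hWu_apply _ hp] at h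
    rwa [hu, kernel_zero_apply hp, v1] at h
  -- If `θ₂(0) = 0`, multiplying `E4` by `w` gives `w = conj φ(0) θ₂(w)`. If `φ(0) = 0`, then `E4`
  -- at `b` reads `1 = 0`.
  rcases mul_eq_zero.mp hprod with h0 | h0
  · have h0' : θ₂ 0 = 0 := (map_eq_zero _).mp h0
    refine ⟨(conj (φ 0))⁻¹, fun w hw => ?_⟩
    have h := E4 w hw
    rw [h0, zero_mul, add_zero] at h
    have hne : conj (φ 0) ≠ 0 := left_ne_zero_of_mul (h ▸ one_ne_zero)
    have h' := hφ_apply w hw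
    rw [h0', sub_zero] at h'
    rw [← h', eq_inv_mul_iff_mul_eq₀ hne]
    linear_combination (-w) * h
  · have h := E4 b hb
    rw [h0, hb0, map_zero, zero_mul, mul_zero, add_zero] at h
    exact absurd h one_ne_zero

end Necessity

/-! ### Sufficiency. -/

/-- Here `V` and `M₁ M₂` have the same range, so `1 - V V*` annihilates every `M₁ M₂ f` and both
sides of the identity are zero. -/
lemma commutesOnKer_of_eq_mul {θ₁ θ₂ : ℂ → ℂ} (h₁ : IsInner θ₁) (h₂ : IsInner θ₂) {c₁ c₂ : ℂ}
    (hn₁ : ‖c₁‖ = 1) (hn₂ : ‖c₂‖ = 1) (hc₁ : ∀ z ∈ Metric.ball (0 : ℂ) 1, θ₁ z = c₁ * z)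
    (hc₂ : ∀ w ∈ Metric.ball (0 : ℂ) 1, θ₂ w = c₂ * w) : CommutesOnKer (prodOp h₁ h₂) := by
  have hV : ∀ f, prodOp h₁ h₂ f = (c₁ * c₂) • M₁ (M₂ f) := fun f => Hardy.ext fun p hp => by
    rw [mulOp_apply, Hardy.smul_apply, M₁_apply, M₂_apply, hc₁ _ hp.1, hc₂ _ hp.2]
    ring
  have hVV : ∀ f, prodOp h₁ h₂ (adjoint (prodOp h₁ h₂) (M₁ (M₂ f))) = M₁ (M₂ f) := fun f => by
    have hne : c₁ * c₂ ≠ 0 := by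
      rw [← norm_ne_zero_iff, norm_mul, hn₁, hn₂, one_mul]
      exact one_ne_zero
    have e : M₁ (M₂ f) = prodOp h₁ h₂ ((c₁ * c₂)⁻¹ • f) := by
      rw [hV, map_smul, map_smul, smul_smul, mul_inv_cancel₀ hne, one_smul]
    rw [e, adjoint_mulOp_mulOp]
  intro f _
  rw [hVV, hVV, sub_self, sub_self, map_zero]

end BidiscHardy
end

theorem theorem3p13 (θ₁ θ₂ : ℂ → ℂ)
    (h₁ : BidiscHardy.IsInner θ₁) (h₂ : BidiscHardy.IsInner θ₂)
    (hz₁ : ∃ a ∈ Metric.ball (0 : ℂ) 1, θ₁ a = 0)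
    (hz₂ : ∃ b ∈ Metric.ball (0 : ℂ) 1, θ₂ b = 0) :
    BidiscHardy.IsPhiDoublyCommuting (BidiscHardy.mulHardy fun p => θ₁ p.1 * θ₂ p.2)ᗮ ↔
      ∃ c₁ c₂ : ℂ, ‖c₁‖ = 1 ∧ ‖c₂‖ = 1 ∧
        (∀ z ∈ Metric.ball (0 : ℂ) 1, θ₁ z = c₁ * z) ∧
        (∀ w ∈ Metric.ball (0 : ℂ) 1, θ₂ w = c₂ * w) := by
  refine (BidiscHardy.isPhiDoublyCommuting_iff (h₁.isInnerBidisc_fst.mul h₂.isInnerBidisc_snd)).trans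
    ⟨fun H => ?_, fun ⟨c₁, c₂, hn₁, hn₂, hc₁, hc₂⟩ =>
      BidiscHardy.commutesOnKer_of_eq_mul h₁ h₂ hn₁ hn₂ hc₁ hc₂⟩
  obtain ⟨c₁, hc₁⟩ := BidiscHardy.exists_eq_mul_fst h₁ h₂ H hz₁
  obtain ⟨c₂, hc₂⟩ := BidiscHardy.exists_eq_mul_snd h₁ h₂ H hc₁ hz₂
  exact ⟨c₁, c₂, h₁.norm_eq_one_of_eq_mul hc₁, h₂.norm_eq_one_of_eq_mul hc₂, hc₁, hc₂⟩
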